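/- Conventions. All manifolds and maps are $C^\infty$. A homotopy sphere $\Sigma^n$ is a closed smooth $n$-manifold homotopy equivalent to $S^n$; $D^p\subset\mathbb R^p$ is the closed unit ball. For $n\ge p\ge 1$, a smooth map $f\colon M^n\to\mathbb R^p$ is *special generic* if every singular point of $f$ is a definite fold point, i.e. there are local coordinates centred at the point and around its image in which $f$ has the form $(x_1,\dots,x_n)\mapsto(x_1,\dots,x_{p-1},\pm(x_p^2+\dots+x_n^2))$. The Stein factorization of $f$ is $f=\overline f\circ q_f$, where $q_f\colon M^n\to W_f$ is the quotient map (with the quotient topology on $W_f$) that identifies two points iff they lie in the same connected component of a fibre of $f$. For $p<n$ and $f$ special generic on a closed connected manifold $M^n$, $W_f$ carries its (unique) structure of a smooth $p$-manifold with boundary for which $q_f$ is smooth, $q_f^{-1}(\partial W_f)$ is the singular locus of $f$, and $\overline f\colon W_f\to\mathbb R^p$ is an immersion. A special generic map $f\colon\Sigma^n\to\mathbb R^p$ with $p<n$ on a homotopy sphere is *standard* if $W_f$ is diffeomorphic to $D^p$. Statement. Let $f\colon\Sigma^n\to\mathbb R^p$ be a standard special generic map, fix a diffeomorphism $W_f\cong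 D^p$, and let $h\colon\Sigma^n\xrightarrow{q_f}W_f\xrightarrow{\cong}D^p\hookrightarrow\mathbb R^p$. Then $h$ is a standard special generic map, and for every $q\in\{1,\dots,p-1\}$ the composition $\pi\circ h\colon\Sigma^n\to\mathbb R^q$ of $h$ with the projection $\pi\colon\mathbb R^p\to\mathbb R^q$ to the first $q$ coordinates is a standard special generic map. -/

import Mathlib

open scoped Manifold ContDiff Topology

/-- A homotopy `n`-sphere: a closed (compact, Hausdorff, boundaryless) smooth `n`-manifold
homotopy equivalent to the standard sphere `S^n`. -/
structure IsHomotopySphere (n : ℕ) (M : Type*) [TopologicalSpace M]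
    [ChartedSpace (EuclideanSpace ℝ (Fin n)) M] : Prop where
  isManifold : IsManifold (𝓡 n) ∞ M
  compactSpace : CompactSpace M
  t2Space : T2Space M
  homotopyEquiv : Nonempty (ContinuousMap.HomotopyEquiv M
    (Metric.sphere (0 : EuclideanSpace ℝ (Fin (n + 1))) 1))

section SpecialGeneric

variable (n : ℕ) {p : ℕ} {M : Type*} [TopologicalSpace M]
  [ChartedSpace (EuclideanSpace ℝ (Fin n)) M]

/-- The singular locus `S(f)` of `f : M^n → ℝ^p` with `p ≤ n`: the points where the differential
does not have rank `p`. -/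
def singularLocus (f : M → EuclideanSpace ℝ (Fin p)) : Set M :=
  {x | ¬ Function.Surjective (mfderiv (𝓡 n) (𝓡 p) f x)}

/-- `x` is a fold point of `f` with exactly `l` positive squares: in smooth local coordinates `φ`
centred at `x` and `ψ` around `f x`, the map `f` is
`(x₁, …, xₙ) ↦ (x₁, …, x_{p-1}, x_p² + ⋯ + x_{p+l-1}² - x_{p+l}² - ⋯ - xₙ²)`.
(Indices in `Fin` start at `0`, so `x_k` is the coordinate with index `k - 1`.) -/
def IsFoldPointWith (f : M → EuclideanSpace ℝ (Fin p)) (x : M) (l : ℕ) : Prop :=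
  l ≤ n + 1 - p ∧
  ∃ φ ∈ IsManifold.maximalAtlas (𝓡 n) ∞ M,
  ∃ ψ ∈ IsManifold.maximalAtlas (𝓡 p) ∞ (EuclideanSpace ℝ (Fin p)),
    x ∈ φ.source ∧ φ x = 0 ∧ Set.MapsTo f φ.source ψ.source ∧
    ∀ z ∈ φ.source,
      (∀ (i : Fin p) (j : Fin n), (i : ℕ) = j → (i : ℕ) + 1 < p → ψ (f z) i = φ z j) ∧
      (∀ i : Fin p, (i : ℕ) + 1 = p →
        ψ (f z) i = ∑ j : Fin n,
          if (j : ℕ) + 1 < p then 0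
          else if (j : ℕ) + 1 < p + l then (φ z j) ^ 2 else -(φ z j) ^ 2)

/-- A definite fold point: a fold point of absolute index `max {l, n - p + 1 - l} = n - p + 1`. -/
def IsDefiniteFoldPoint (f : M → EuclideanSpace ℝ (Fin p)) (x : M) : Prop :=
  ∃ l : ℕ, IsFoldPointWith n f x l ∧ max l (n + 1 - p - l) = n + 1 - p

/-- A special generic map `M^n → ℝ^p` (`n ≥ p ≥ 1`): a smooth map whose singular points are all
definite fold points. -/
structure IsSpecialGeneric (f : M → EuclideanSpace ℝ (Fin p)) : Prop where
  one_le : 1 ≤ p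
  le : p ≤ n
  smooth : ContMDiff (𝓡 n) (𝓡 p) ∞ f
  definite : ∀ x ∈ singularLocus n f, IsDefiniteFoldPoint n f x

end SpecialGeneric

section Stein

variable {X Y : Type*} [TopologicalSpace X]

/-- `x₁ ∼ x₂` iff both have the same image `y` and lie in the same connected component of the
fibre over `y`. -/
def steinSetoid (f : X → Y) : Setoid X where
  r x₁ x₂ := f x₁ = f x₂ ∧ x₂ ∈ connectedComponentIn (f ⁻¹' {f x₁}) x₁
  iseqv := by
    refine ⟨fun x => ⟨rfl, mem_connectedComponentIn rfl⟩, ?_, ?_⟩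
    · rintro x y ⟨h, hy⟩
      refine ⟨h.symm, ?_⟩
      rw [← h, ← connectedComponentIn_eq hy]
      exact mem_connectedComponentIn rfl
    · rintro x y z ⟨h, hy⟩ ⟨h', hz⟩
      refine ⟨h.trans h', ?_⟩
      rw [← h, ← connectedComponentIn_eq hy] at hz
      exact hz

/-- The space `W_f = X / ∼_f` of the Stein factorization. -/
def SteinSpace (f : X → Y) : Type _ := Quotient (steinSetoid f)

/-- `W_f` carries the quotient topology. -/
instance (f : X → Y) : TopologicalSpace (SteinSpace f) :=
  inferInstanceAs (TopologicalSpace (Quotient (steinSetoid f)))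

/-- The quotient map `q_f : X → W_f`. -/
def steinQuot (f : X → Y) : X → SteinSpace f := Quotient.mk (steinSetoid f)

/-- The induced map `W_f → Y`. -/
def steinBar (f : X → Y) : SteinSpace f → Y := Quotient.lift f fun _ _ h => h.1

end Stein

section Standard

variable (n : ℕ) {p : ℕ} [NeZero p] {M : Type*} [TopologicalSpace M]
  [ChartedSpace (EuclideanSpace ℝ (Fin n)) M]

/-- The given atlas makes `W_f` a smooth `p`-manifold with boundary such that `q_f` is smooth,
`q_f⁻¹(∂ W_f) = S(f)`, and the induced map `W_f → ℝ^p` is an immersion. (Since the latter is an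
immersion between spaces of the same dimension, there is at most one such smooth structure.) -/
structure IsSteinSmoothStructure (f : M → EuclideanSpace ℝ (Fin p))
    [ChartedSpace (EuclideanHalfSpace p) (SteinSpace f)] : Prop where
  isManifold : IsManifold (𝓡∂ p) ∞ (SteinSpace f)
  smooth_quot : ContMDiff (𝓡 n) (𝓡∂ p) ∞ (steinQuot f)
  preimage_boundary : steinQuot f ⁻¹' ((𝓡∂ p).boundary (SteinSpace f)) = singularLocus n f
  smooth_bar : ContMDiff (𝓡∂ p) (𝓡 p) ∞ (steinBar f)
  injective_mfderiv_bar :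
    ∀ w : SteinSpace f, Function.Injective (mfderiv (𝓡∂ p) (𝓡 p) (steinBar f) w)

/-- `Φ`, composed with the inclusion `D^p ⊂ ℝ^p` of the closed unit ball, is a diffeomorphism of
the manifold with boundary `W` onto `D^p`: it is smooth with image `D^p`, and has an inverse that
is smooth on the subset `D^p` of `ℝ^p` (the values of `Ψ` outside `D^p` are irrelevant). -/
structure IsDiffeoOntoDisk {W : Type*} [TopologicalSpace W] [ChartedSpace (EuclideanHalfSpace p) W]
    (Φ : W → EuclideanSpace ℝ (Fin p)) : Prop where
  range_eq : Set.range Φ = Metric.closedBall 0 1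
  smooth : ContMDiff (𝓡∂ p) (𝓡 p) ∞ Φ
  smooth_inverse : ∃ Ψ : EuclideanSpace ℝ (Fin p) → W,
    ContMDiffOn (𝓡 p) (𝓡∂ p) ∞ Ψ (Metric.closedBall 0 1) ∧ ∀ w, Ψ (Φ w) = w

/-- A standard special generic map `Σ^n → ℝ^p` (`p < n`): a special generic map on a homotopy
sphere whose Stein factorization `W_f`, with its smooth structure, is diffeomorphic to `D^p`. -/
structure IsStandardSpecialGeneric (f : M → EuclideanSpace ℝ (Fin p)) : Prop where
  homotopySphere : IsHomotopySphere n M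
  lt : p < n
  specialGeneric : IsSpecialGeneric n f
  standard : ∃ _ : ChartedSpace (EuclideanHalfSpace p) (SteinSpace f),
    IsSteinSmoothStructure n f ∧ ∃ Φ : SteinSpace f → EuclideanSpace ℝ (Fin p), IsDiffeoOntoDisk Φ

end Standard

/-- The projection `ℝ^p → ℝ^q` to the first `q` coordinates. -/
def projFirst {p q : ℕ} (h : q ≤ p) (x : EuclideanSpace ℝ (Fin p)) : EuclideanSpace ℝ (Fin q) :=
  WithLp.toLp 2 fun i => x (Fin.castLE h i)

/-!
Let `h` be the composition of `q_f` with `W_f ≅ D^p`, so that `f = g ∘ h` with `g` an immersion of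
the ball and `‖h‖ = 1` exactly on the singular set of `f`.

Near a singular point `x`, choose charts `φ` and `ψ` in which `f` is `(u, v) ↦ (u, ±‖v‖²)`. The last
component `G` of `ψ ∘ g` vanishes on the unit sphere near `h x`, so integrating along radii gives
`G ∘ h = (1 - ‖h‖²) E` with `E` smooth. Moreover `E ≠ 0` at `x`, since the radial derivative of `G`
at `h x` does not vanish. Hence `1 - ‖h‖²` is `‖v‖²` times a positive smooth function, and after
rescaling `v` and replacing `u` by all but one of the components of `h` one obtains a chart of `M`
in which `1 - ‖h‖² = ‖v‖²` (an adapted chart); the omitted component may be any one that does not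
vanish at `x`.

If some `h_k x ≠ 0` with `k > q`, omitting it shows that `π ∘ h` is a submersion at `x`. Otherwise
`‖π (h x)‖ = 1`; omit a component `h_i` with `i ≤ q`. Since
`1 - ‖π ∘ h‖² = (1 - ‖h‖²) + ∑_{k > q} h_k²` is then a sum of squares of coordinates of the adapted
chart, `π ∘ h` is a definite fold, with `1 - ‖y‖²` as the last coordinate on `ℝ^q`. So `π ∘ h` is
special generic with singular set `‖π ∘ h‖ = 1`. Its fibres are preimages under `h` of convex slices
of the ball and hence connected, so its Stein space embeds into `ℝ^q` with image `D^q`, whose smooth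
structure it inherits. The case `q = p` is the statement about `h` itself.
-/

section ParametricIntegral

theorem continuous_prodMk_of_continuousOn_prod_univ {X Y Z : Type*} [TopologicalSpace X]
    [TopologicalSpace Y] [TopologicalSpace Z] {H : X × Y → Z} {U : Set X}
    (hH : ContinuousOn H (U ×ˢ Set.univ)) {x : X} (hx : x ∈ U) :
    Continuous fun t => H (x, t) :=
  hH.comp_continuous (by fun_prop) fun t => ⟨hx, Set.mem_univ t⟩

variable {V E : Type*} [NormedAddCommGroup V] [NormedSpace ℝ V] [FiniteDimensional ℝ V]
  [NormedAddCommGroup E] [NormedSpace ℝ E] {F : V × ℝ → E} {U : Set V}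

theorem hasFDerivAt_intervalIntegral_of_contDiffOn (hU : IsOpen U)
    (hF : ContDiffOn ℝ 1 F (U ×ˢ Set.univ)) (a b : ℝ) {x₀ : V} (hx₀ : x₀ ∈ U) :
    HasFDerivAt (fun x => ∫ t in a..b, F (x, t))
      (∫ t in a..b, (fderiv ℝ F (x₀, t)).comp (ContinuousLinearMap.inl ℝ V ℝ)) x₀ := by
  have hopen : IsOpen (U ×ˢ (Set.univ : Set ℝ)) := hU.prod isOpen_univ
  have hF' : ContinuousOn (fun z => (fderiv ℝ F z).comp (ContinuousLinearMap.inl ℝ V ℝ))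
      (U ×ˢ Set.univ) :=
    (hF.continuousOn_fderiv_of_isOpen hopen le_rfl).clm_comp continuousOn_const
  obtain ⟨r, hr, hrU⟩ := Metric.nhds_basis_closedBall.mem_iff.1 (hU.mem_nhds hx₀)
  obtain ⟨C, hC⟩ := ((isCompact_closedBall x₀ r).prod (isCompact_uIcc (a := a) (b := b))
    ).exists_bound_of_continuousOn (hF'.mono fun z hz => ⟨hrU hz.1, Set.mem_univ _⟩)
  refine intervalIntegral.hasFDerivAt_integral_of_dominated_of_fderiv_le
    (F' := fun x t => (fderiv ℝ F (x, t)).comp (ContinuousLinearMap.inl ℝ V ℝ))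
    (bound := fun _ => C) (Metric.closedBall_mem_nhds x₀ hr) ?_
    ((continuous_prodMk_of_continuousOn_prod_univ hF.continuousOn hx₀).intervalIntegrable _ _)
    (continuous_prodMk_of_continuousOn_prod_univ hF' hx₀).aestronglyMeasurable
    (.of_forall fun t ht x hx => hC (x, t) ⟨hx, Set.uIoc_subset_uIcc ht⟩)
    intervalIntegrable_const (.of_forall fun t _ x hx => ?_)
  · filter_upwards [hU.mem_nhds hx₀] with x hx
    exact (continuous_prodMk_of_continuousOn_prod_univ hF.continuousOn hx).aestronglyMeasurable
  · have hFx : HasFDerivAt F (fderiv ℝ F (x, t)) (x, t) :=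
      ((hF.differentiableOn one_ne_zero).differentiableAt
        (hopen.mem_nhds ⟨hrU hx, Set.mem_univ t⟩)).hasFDerivAt
    exact hFx.comp x (hasFDerivAt_prodMk_left x t)

theorem contDiffOn_intervalIntegral (hU : IsOpen U)
    (hF : ContDiffOn ℝ ∞ F (U ×ˢ Set.univ)) (a b : ℝ) :
    ContDiffOn ℝ ∞ (fun x => ∫ t in a..b, F (x, t)) U := by
  have hopen : IsOpen (U ×ˢ (Set.univ : Set ℝ)) := hU.prod isOpen_univ
  rw [contDiffOn_infty]
  intro m
  induction m generalizing F with
  | zero =>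
    exact contDiffOn_zero.2 fun x hx => (hasFDerivAt_intervalIntegral_of_contDiffOn hU
      (hF.of_le (by simp)) a b hx).continuousAt.continuousWithinAt
  | succ m ih =>
    have hderiv : ∀ x ∈ U, HasFDerivAt _ _ x := fun x hx =>
      hasFDerivAt_intervalIntegral_of_contDiffOn hU (hF.of_le (by simp)) a b hx
    have hF' : ContDiffOn ℝ ∞ (fderiv ℝ F) (U ×ˢ Set.univ) :=
      hF.fderiv_of_isOpen hopen (by simp)
    push_cast
    rw [contDiffOn_succ_iff_fderiv_of_isOpen hU, contDiffOn_clm_apply]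
    refine ⟨fun x hx => (hderiv x hx).differentiableAt.differentiableWithinAt, by simp,
      fun y => (ih (hF'.clm_apply (contDiffOn_const (c := (y, (0 : ℝ)))))).congr fun x hx => ?_⟩
    have hintegrable : IntervalIntegrable (fun t =>
        (fderiv ℝ F (x, t)).comp (ContinuousLinearMap.inl ℝ V ℝ)) MeasureTheory.volume a b :=
      (continuous_prodMk_of_continuousOn_prod_univ (hF'.continuousOn.clm_comp continuousOn_const)
        hx).intervalIntegrable _ _
    rw [(hderiv x hx).fderiv, ContinuousLinearMap.intervalIntegral_apply hintegrable]
    simp only [ContinuousLinearMap.comp_apply, ContinuousLinearMap.inl_apply]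

end ParametricIntegral

section RadialDivision

open Real (smoothTransition)

theorem integral_deriv_smoothTransition : ∫ s in (0 : ℝ)..1, deriv smoothTransition s = 1 := by
  have hsmooth : ContDiff ℝ 1 smoothTransition := Real.smoothTransition.contDiff
  rw [intervalIntegral.integral_deriv_eq_sub (fun s _ => hsmooth.differentiable one_ne_zero s)
    ((hsmooth.continuous_deriv le_rfl).intervalIntegrable _ _),
    Real.smoothTransition.one, Real.smoothTransition.zero, sub_zero]

variable {F : Type*} [NormedAddCommGroup F]

-- Reparametrized by `smoothTransition`, the segment stays in `C` for all real times, so that the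
-- integrand is defined and smooth on an open set of times, as `contDiffOn_intervalIntegral` needs.
theorem sub_eq_intervalIntegral_smoothTransition [NormedSpace ℝ F] {C : Set F} (hC : Convex ℝ C)
    (hCd : UniqueDiffOn ℝ C) {G : F → ℝ} (hG : ContDiffOn ℝ 1 G C) {x y : F} (hx : x ∈ C)
    (hy : y ∈ C) :
    G y - G x = ∫ s in (0 : ℝ)..1, deriv smoothTransition s *
      fderivWithin ℝ G C (AffineMap.lineMap x y (smoothTransition s)) (y - x) := by
  have htrans : ContDiff ℝ 1 smoothTransition := Real.smoothTransition.contDiff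
  have hmem : ∀ s, AffineMap.lineMap x y (smoothTransition s) ∈ C := fun s =>
    hC.lineMap_mem hx hy ⟨Real.smoothTransition.nonneg s, Real.smoothTransition.le_one s⟩
  have hpath : ∀ s, HasDerivAt (fun s => AffineMap.lineMap x y (smoothTransition s))
      (deriv smoothTransition s • (y - x)) s := fun s =>
    AffineMap.hasDerivAt_lineMap.scomp s (htrans.differentiable one_ne_zero s).hasDerivAt
  have hderiv : ∀ s, HasDerivAt (fun s => G (AffineMap.lineMap x y (smoothTransition s)))
      (deriv smoothTransition s *
        fderivWithin ℝ G C (AffineMap.lineMap x y (smoothTransition s)) (y - x)) s := fun s => by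
    rw [← smul_eq_mul, ← map_smul]
    exact ((hG.differentiableOn one_ne_zero _ (hmem s)).hasFDerivWithinAt).comp_hasDerivAt
      s (hpath s) (.of_forall hmem)
  have hcont : Continuous fun s => deriv smoothTransition s *
      fderivWithin ℝ G C (AffineMap.lineMap x y (smoothTransition s)) (y - x) :=
    (htrans.continuous_deriv le_rfl).mul
      (((hG.continuousOn_fderivWithin hCd le_rfl).comp_continuous
        (continuous_iff_continuousAt.2 fun s => (hpath s).continuousAt) hmem).clm_apply
          continuous_const)
  rw [intervalIntegral.integral_eq_sub_of_hasDerivAt (fun s _ => hderiv s)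
    (hcont.intervalIntegrable 0 1)]
  simp

theorem sub_normalize_eq_smul [NormedSpace ℝ F] {y : F} (hy : y ≠ 0) :
    y - ‖y‖⁻¹ • y = (1 - ‖y‖ ^ 2) • (-(‖y‖ * (1 + ‖y‖))⁻¹ • y) := by
  have : 0 < ‖y‖ := norm_pos_iff.2 hy
  have hcoeff : (1 - ‖y‖ ^ 2) * -(‖y‖ * (1 + ‖y‖))⁻¹ = 1 - ‖y‖⁻¹ := by
    field_simp
    ring
  rw [smul_smul, hcoeff, sub_smul, one_smul]

theorem uniqueDiffOn_closedBall [NormedSpace ℝ F] : UniqueDiffOn ℝ (Metric.closedBall (0 : F) 1) :=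
  uniqueDiffOn_convex (convex_closedBall 0 1) (by
    rw [interior_closedBall _ one_ne_zero]
    exact Metric.nonempty_ball.2 one_pos)

theorem eventually_ne_zero_and_normalize_mem_ball [NormedSpace ℝ F] {y₀ : F} (hy₀ : ‖y₀‖ = 1)
    {r : ℝ} (hr : 0 < r) :
    ∀ᶠ y in 𝓝 y₀, y ≠ 0 ∧ y ∈ Metric.ball y₀ r ∧ ‖y‖⁻¹ • y ∈ Metric.ball y₀ r := by
  have hne : y₀ ≠ 0 := norm_ne_zero_iff.1 (hy₀ ▸ one_ne_zero)
  have hcont : ContinuousAt (fun y : F => ‖y‖⁻¹ • y) y₀ :=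
    (continuous_norm.continuousAt.inv₀ (norm_ne_zero_iff.2 hne)).smul continuousAt_id
  have hmem : ‖y₀‖⁻¹ • y₀ ∈ Metric.ball y₀ r := by simpa [hy₀] using hr
  filter_upwards [isOpen_ne.mem_nhds hne, Metric.ball_mem_nhds y₀ hr,
    hcont.eventually_mem (Metric.isOpen_ball.mem_nhds hmem)]
    with y h₁ h₂ h₃ using ⟨h₁, h₂, h₃⟩

variable {V : Type*} [NormedAddCommGroup V] [NormedSpace ℝ V] [InnerProductSpace ℝ F]

theorem contDiffOn_radialIntegrand {G : F → ℝ} {C : Set F} {η : V → F} {U : Set V}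
    (hη : ContDiffOn ℝ ∞ η U) (hη0 : ∀ v ∈ U, η v ≠ 0) (hηC : ∀ v ∈ U, η v ∈ C)
    (hηC' : ∀ v ∈ U, ‖η v‖⁻¹ • η v ∈ C) (hC : Convex ℝ C) (hCd : UniqueDiffOn ℝ C)
    (hG : ContDiffOn ℝ ∞ G C) :
    ContDiffOn ℝ ∞ (fun z : V × ℝ => deriv smoothTransition z.2 *
      fderivWithin ℝ G C
        (AffineMap.lineMap (‖η z.1‖⁻¹ • η z.1) (η z.1) (smoothTransition z.2))
        (-(‖η z.1‖ * (1 + ‖η z.1‖))⁻¹ • η z.1)) (U ×ˢ Set.univ) := by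
  have hfst : ContDiffOn ℝ ∞ (fun z : V × ℝ => η z.1) (U ×ˢ Set.univ) :=
    hη.comp contDiffOn_fst fun _ hz => hz.1
  have hnorm : ContDiffOn ℝ ∞ (fun z : V × ℝ => ‖η z.1‖) (U ×ˢ Set.univ) :=
    hfst.norm ℝ fun z hz => hη0 _ hz.1
  have hpos : ∀ z ∈ U ×ˢ (Set.univ : Set ℝ), 0 < ‖η z.1‖ := fun z hz =>
    norm_pos_iff.2 (hη0 _ hz.1)
  have htrans : ContDiff ℝ ∞ smoothTransition := Real.smoothTransition.contDiff
  have hnormalize : ContDiffOn ℝ ∞ (fun z : V × ℝ => ‖η z.1‖⁻¹ • η z.1) (U ×ˢ Set.univ) :=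
    (hnorm.inv fun z hz => (hpos z hz).ne').smul hfst
  have hpath : ContDiffOn ℝ ∞ (fun z : V × ℝ => AffineMap.lineMap (‖η z.1‖⁻¹ • η z.1) (η z.1)
      (smoothTransition z.2)) (U ×ˢ Set.univ) := by
    simp only [AffineMap.lineMap_apply_module']
    exact ((htrans.comp contDiff_snd).contDiffOn.smul (hfst.sub hnormalize)).add hnormalize
  have hspeed : ContDiffOn ℝ ∞ (fun z : V × ℝ => -(‖η z.1‖ * (1 + ‖η z.1‖))⁻¹ • η z.1)
      (U ×ˢ Set.univ) := by
    refine ((hnorm.mul (contDiffOn_const.add hnorm)).inv fun z hz => ?_).neg.smul hfst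
    have := hpos z hz
    positivity
  refine (((contDiff_infty_iff_deriv.1 htrans).2.comp contDiff_snd).contDiffOn).mul
    (((hG.fderivWithin hCd (m := ∞) (by simp)).comp hpath fun z hz => ?_).clm_apply hspeed)
  exact hC.lineMap_mem (hηC' _ hz.1) (hηC _ hz.1)
    ⟨Real.smoothTransition.nonneg _, Real.smoothTransition.le_one _⟩

variable [FiniteDimensional ℝ V]

theorem exists_comp_eq_one_sub_norm_sq_mul {G : F → ℝ} {r : ℝ} {η : V → F} {U : Set V} {v₀ : V}
    (hU : IsOpen U) (hv₀ : v₀ ∈ U) (hη : ContDiffOn ℝ ∞ η U) (hηU : ∀ v ∈ U, ‖η v‖ ≤ 1)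
    (hηv₀ : ‖η v₀‖ = 1) (hr : 0 < r)
    (hG : ContDiffOn ℝ ∞ G (Metric.closedBall 0 1 ∩ Metric.ball (η v₀) r))
    (hG0 : ∀ y ∈ Metric.ball (η v₀) r, ‖y‖ = 1 → G y = 0) :
    ∃ U' ⊆ U, IsOpen U' ∧ v₀ ∈ U' ∧ ∃ E : V → ℝ, ContDiffOn ℝ ∞ E U' ∧
      (∀ v ∈ U', G (η v) = (1 - ‖η v‖ ^ 2) * E v) ∧
      E v₀ = -(fderivWithin ℝ G (Metric.closedBall 0 1) (η v₀) (η v₀)) / 2 := by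
  set C := Metric.closedBall (0 : F) 1 ∩ Metric.ball (η v₀) r with hC_def
  have hC : Convex ℝ C := (convex_closedBall 0 1).inter (convex_ball _ r)
  have hCd : UniqueDiffOn ℝ C := uniqueDiffOn_closedBall.inter Metric.isOpen_ball
  obtain ⟨O, hO, hOo, hv₀O⟩ := eventually_nhds_iff.1
    (eventually_ne_zero_and_normalize_mem_ball hηv₀ hr)
  have hηC : ∀ v ∈ U ∩ η ⁻¹' O, η v ∈ C := fun v hv =>
    ⟨mem_closedBall_zero_iff.2 (hηU v hv.1), (hO _ hv.2).2.1⟩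
  have hnormalize : ∀ v ∈ U ∩ η ⁻¹' O, ‖‖η v‖⁻¹ • η v‖ = 1 := fun v hv =>
    norm_smul_inv_norm (𝕜 := ℝ) (hO _ hv.2).1
  have hηC' : ∀ v ∈ U ∩ η ⁻¹' O, ‖η v‖⁻¹ • η v ∈ C := fun v hv =>
    ⟨mem_closedBall_zero_iff.2 (hnormalize v hv).le, (hO _ hv.2).2.2⟩
  have hU'o : IsOpen (U ∩ η ⁻¹' O) := hη.continuousOn.isOpen_inter_preimage hU hOo
  refine ⟨U ∩ η ⁻¹' O, Set.inter_subset_left, hU'o, ⟨hv₀, hv₀O⟩, _,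
    contDiffOn_intervalIntegral hU'o (contDiffOn_radialIntegrand (hη.mono Set.inter_subset_left)
      (fun v hv => (hO _ hv.2).1) hηC hηC' hC hCd hG) 0 1, fun v hv => ?_, ?_⟩
  · have hsub := sub_eq_intervalIntegral_smoothTransition hC hCd (hG.of_le (by simp))
      (hηC' v hv) (hηC v hv)
    rw [hG0 _ (hO _ hv.2).2.2 (hnormalize v hv), sub_zero,
      sub_normalize_eq_smul (hO _ hv.2).1] at hsub
    rw [hsub, ← intervalIntegral.integral_const_mul]
    refine intervalIntegral.integral_congr fun s _ => ?_
    simp only [map_smul, smul_eq_mul]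
    ring
  · simp only [hηv₀, inv_one, one_smul, AffineMap.lineMap_same, AffineMap.const_apply,
      intervalIntegral.integral_mul_const, integral_deriv_smoothTransition, one_mul, hC_def,
      fderivWithin_inter (Metric.ball_mem_nhds (η v₀) hr), map_smul, smul_eq_mul]
    ring

end RadialDivision

section Coordinates

variable {m : ℕ}

theorem mem_contDiffGroupoid_of_contDiffOn
    {e : OpenPartialHomeomorph (EuclideanSpace ℝ (Fin m)) (EuclideanSpace ℝ (Fin m))}
    (he : ContDiffOn ℝ ∞ e e.source) (he' : ContDiffOn ℝ ∞ e.symm e.target) :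
    e ∈ contDiffGroupoid ∞ (𝓡 m) := by
  rw [contDiffGroupoid, mem_groupoid_of_pregroupoid]
  simp only [contDiffPregroupoid, modelWithCornersSelf_coe, modelWithCornersSelf_coe_symm,
    Function.id_comp, Function.comp_id, Set.preimage_id, Set.range_id, Set.inter_univ]
  exact ⟨he, he'⟩

theorem exists_openPartialHomeomorph_of_hasFDerivAt_equiv {E : Type*} [NormedAddCommGroup E]
    [NormedSpace ℝ E] [CompleteSpace E] {κ : E → E} {a : E} {U : Set E} (hU : IsOpen U)
    (ha : a ∈ U) (hκ : ContDiffOn ℝ ∞ κ U) {D : E ≃L[ℝ] E} (hD : HasFDerivAt κ (D : E →L[ℝ] E) a) :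
    ∃ e : OpenPartialHomeomorph E E, a ∈ e.source ∧ e.source ⊆ U ∧ ⇑e = κ ∧
      ContDiffOn ℝ ∞ e e.source ∧ ContDiffOn ℝ ∞ e.symm e.target := by
  have hκat : ∀ v ∈ U, ContDiffAt ℝ ∞ κ v := fun v hv => hκ.contDiffAt (hU.mem_nhds hv)
  let e₀ := (hκat a ha).toOpenPartialHomeomorph κ hD (by simp)
  have hinv : ∀ᶠ v in 𝓝 a, fderiv ℝ κ v ∈ Set.range ((↑) : (E ≃L[ℝ] E) → E →L[ℝ] E) :=
    ((hκat a ha).fderiv_right (m := ∞) (by simp)).continuousAt.eventually_mem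
      (hD.fderiv ▸ ContinuousLinearEquiv.nhds D)
  obtain ⟨s, hs, hso, has⟩ := eventually_nhds_iff.1 ((hU.eventually_mem ha).and hinv)
  have hsrc : (e₀.restr s).source = e₀.source ∩ s := by rw [e₀.restr_source, hso.interior_eq]
  refine ⟨e₀.restr s, hsrc ▸ ⟨(hκat a ha).mem_toOpenPartialHomeomorph_source hD (by simp), has⟩,
    fun v hv => (hs v (hsrc ▸ hv).2).1, rfl,
    fun v hv => (hκat v (hs v (hsrc ▸ hv).2).1).contDiffWithinAt, fun v hv => ?_⟩
  have hmem := hs _ (hsrc ▸ (e₀.restr s).map_target hv).2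
  obtain ⟨D', hD'⟩ := hmem.2
  refine ((e₀.restr s).contDiffAt_symm (f₀' := D') hv ?_ (hκat _ hmem.1)).contDiffWithinAt
  exact hD' ▸ ((hκat _ hmem.1).differentiableAt (by simp)).hasFDerivAt

theorem exists_mem_contDiffGroupoid_of_coordinates {κ : Fin m → EuclideanSpace ℝ (Fin m) → ℝ}
    {a : EuclideanSpace ℝ (Fin m)} {U : Set (EuclideanSpace ℝ (Fin m))} (hU : IsOpen U)
    (ha : a ∈ U) (hκ : ∀ i, ContDiffOn ℝ ∞ (κ i) U)
    (hinj : ∀ w, (∀ i, fderiv ℝ (κ i) a w = 0) → w = 0) :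
    ∃ e ∈ contDiffGroupoid ∞ (𝓡 m), a ∈ e.source ∧ e.source ⊆ U ∧ ∀ v i, e v i = κ i v := by
  let K : EuclideanSpace ℝ (Fin m) → EuclideanSpace ℝ (Fin m) := fun v => WithLp.toLp 2 (κ · v)
  have hK : ContDiffOn ℝ ∞ K U := contDiffOn_euclidean.2 hκ
  have hKa : HasFDerivAt K (fderiv ℝ K a) a :=
    ((hK.contDiffAt (hU.mem_nhds ha)).differentiableAt (by simp)).hasFDerivAt
  have hcoord : ∀ w i, fderiv ℝ (κ i) a w = fderiv ℝ K a w i := fun w i =>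
    congrArg (· w) ((EuclideanSpace.proj (𝕜 := ℝ) i).hasFDerivAt.comp a hKa).fderiv
  obtain ⟨D, hD⟩ : ∃ D : EuclideanSpace ℝ (Fin m) ≃L[ℝ] EuclideanSpace ℝ (Fin m),
      (D : EuclideanSpace ℝ (Fin m) →L[ℝ] EuclideanSpace ℝ (Fin m)) = fderiv ℝ K a :=
    ⟨(LinearEquiv.ofInjectiveEndo (fderiv ℝ K a).toLinearMap
      ((injective_iff_map_eq_zero _).2 fun w hw => hinj w fun i => by
        rw [hcoord, ← ContinuousLinearMap.coe_coe, hw, PiLp.zero_apply])).toContinuousLinearEquiv,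
      rfl⟩
  obtain ⟨e, hae, heU, hek, he, he'⟩ :=
    exists_openPartialHomeomorph_of_hasFDerivAt_equiv hU ha hK (hD ▸ hKa)
  exact ⟨e, mem_contDiffGroupoid_of_contDiffOn he he', hae, heU, fun v i => by rw [hek]⟩

theorem eq_zero_of_inner_eq_zero_of_forall_ne {ι : Type*} [Fintype ι] {y w : EuclideanSpace ℝ ι}
    {i₀ : ι} (hy : y i₀ ≠ 0) (hinner : inner ℝ y w = 0) (hw : ∀ i ≠ i₀, w i = 0) : w = 0 := by
  have hi₀ : w i₀ = 0 := by
    rw [PiLp.inner_apply, Fintype.sum_eq_single i₀ fun i hi => by rw [hw i hi, inner_zero_right]]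
      at hinner
    exact (mul_eq_zero.1 hinner).resolve_right hy
  ext i
  by_cases h : i = i₀
  · rw [h, hi₀, PiLp.zero_apply]
  · exact hw i h

theorem exists_sphere_coordinates {z₀ : EuclideanSpace ℝ (Fin m)} (σ : Equiv.Perm (Fin m))
    {r : Fin m} (hz₀ : z₀ (σ r) ≠ 0) (c : Fin m → ℝ) :
    ∃ e ∈ contDiffGroupoid ∞ (𝓡 m), z₀ ∈ e.source ∧
      ∀ z i, e z i = if i = r then 1 - ‖z‖ ^ 2 else z (σ i) - c i := by
  have hproj : ∀ i, HasFDerivAt (fun z : EuclideanSpace ℝ (Fin m) => z (σ i) - c i)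
      (EuclideanSpace.proj (σ i) : EuclideanSpace ℝ (Fin m) →L[ℝ] ℝ) z₀ := fun i =>
    (EuclideanSpace.proj (𝕜 := ℝ) (σ i)).hasFDerivAt.sub_const _
  have hnorm : HasFDerivAt (fun z : EuclideanSpace ℝ (Fin m) => 1 - ‖z‖ ^ 2)
      (-(2 • innerSL ℝ z₀)) z₀ := (hasStrictFDerivAt_norm_sq z₀).hasFDerivAt.const_sub 1
  let κ : Fin m → EuclideanSpace ℝ (Fin m) → ℝ := fun i z =>
    if i = r then 1 - ‖z‖ ^ 2 else z (σ i) - c i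
  have hκ : ∀ i, ContDiffOn ℝ ∞ (κ i) Set.univ := fun i => by
    by_cases hi : i = r
    · simpa only [κ, hi, if_true] using (contDiff_const.sub (contDiff_norm_sq ℝ)).contDiffOn
    · simp only [κ, hi, if_false]
      fun_prop
  have hinj : ∀ w, (∀ i, fderiv ℝ (κ i) z₀ w = 0) → w = 0 := fun w hw => by
    refine eq_zero_of_inner_eq_zero_of_forall_ne hz₀ ?_ fun k hk => ?_
    · have hr := hw r
      simp only [κ, if_true, hnorm.fderiv] at hr
      simpa using hr
    · have hkr : σ.symm k ≠ r := fun h => hk (by rw [← h, σ.apply_symm_apply])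
      have hk0 := hw (σ.symm k)
      simp only [κ, hkr, if_false] at hk0
      rw [(hproj (σ.symm k)).fderiv] at hk0
      simpa using hk0
  obtain ⟨e, he, hz₀e, -, heq⟩ :=
    exists_mem_contDiffGroupoid_of_coordinates isOpen_univ (Set.mem_univ z₀) hκ hinj
  exact ⟨e, he, hz₀e, heq⟩

end Coordinates

section Disk

variable {q : ℕ}

/-- A topological embedding onto the closed unit ball of `ℝ^q`, used to transport the smooth
structure of the ball. -/
structure IsDiskEmbedding {W : Type*} [TopologicalSpace W] (ε : W → EuclideanSpace ℝ (Fin q)) :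
    Prop extends Topology.IsEmbedding ε where
  range_eq : Set.range ε = Metric.closedBall 0 1

namespace IsDiskEmbedding

variable {W : Type*} [TopologicalSpace W] {ε : W → EuclideanSpace ℝ (Fin q)}

theorem norm_le_one (hε : IsDiskEmbedding ε) (w : W) : ‖ε w‖ ≤ 1 :=
  mem_closedBall_zero_iff.1 (hε.range_eq ▸ Set.mem_range_self w)

theorem nonempty (hε : IsDiskEmbedding ε) : Nonempty W :=
  Set.range_nonempty_iff_nonempty.1 (by
    rw [hε.range_eq]
    exact Metric.nonempty_closedBall.2 zero_le_one)

/-- The inverse of an embedding onto the ball, with irrelevant values outside the ball. -/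
noncomputable def inverse (hε : IsDiskEmbedding ε) : EuclideanSpace ℝ (Fin q) → W :=
  have := hε.nonempty
  Function.invFun ε

theorem inverse_apply (hε : IsDiskEmbedding ε) (w : W) : hε.inverse (ε w) = w :=
  have := hε.nonempty
  Function.leftInverse_invFun hε.injective w

theorem apply_inverse (hε : IsDiskEmbedding ε) {z : EuclideanSpace ℝ (Fin q)} (hz : ‖z‖ ≤ 1) :
    ε (hε.inverse z) = z := by
  obtain ⟨w, rfl⟩ : z ∈ Set.range ε := hε.range_eq ▸ mem_closedBall_zero_iff.2 hz
  rw [hε.inverse_apply]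

end IsDiskEmbedding

variable [NeZero q]

/-- Smooth coordinates of `ℝ^q` in which the closed unit ball is the half-space `0 ≤ x₀` and the
unit sphere is its boundary. -/
structure IsBallChart (e : OpenPartialHomeomorph (EuclideanSpace ℝ (Fin q))
    (EuclideanSpace ℝ (Fin q))) : Prop where
  mem_groupoid : e ∈ contDiffGroupoid ∞ (𝓡 q)
  norm_le_one_iff : ∀ z ∈ e.source, ‖z‖ ≤ 1 ↔ 0 ≤ e z 0
  norm_eq_one_iff : ∀ z ∈ e.source, ‖z‖ = 1 ↔ e z 0 = 0

theorem exists_isBallChart_of_norm_lt_one {z₀ : EuclideanSpace ℝ (Fin q)} (hz₀ : ‖z₀‖ < 1) :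
    ∃ e, IsBallChart e ∧ z₀ ∈ e.source := by
  let t : EuclideanSpace ℝ (Fin q) := PiLp.single 2 0 1
  obtain ⟨e, he, hz₀e, hball, heq⟩ := exists_mem_contDiffGroupoid_of_coordinates
    (κ := fun i z => z i + t i) Metric.isOpen_ball (mem_ball_zero_iff.2 hz₀)
    (fun i => by fun_prop) (fun w hw => by
      ext i
      have hproj : HasFDerivAt (fun z : EuclideanSpace ℝ (Fin q) => z i + t i)
          (EuclideanSpace.proj i : EuclideanSpace ℝ (Fin q) →L[ℝ] ℝ) z₀ :=
        (EuclideanSpace.proj (𝕜 := ℝ) i).hasFDerivAt.add_const _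
      simpa [hproj.fderiv] using hw i)
  have hnorm : ∀ z ∈ e.source, ‖z‖ < 1 := fun z hz => mem_ball_zero_iff.1 (hball hz)
  have hpos : ∀ z ∈ e.source, 0 < e z 0 := fun z hz => by
    have hz0 := (abs_lt.1 ((PiLp.norm_apply_le z 0).trans_lt (hnorm z hz))).1
    simp only [heq, t, PiLp.single_apply, if_true]
    linarith
  exact ⟨e, ⟨he, fun z hz => iff_of_true (hnorm z hz).le (hpos z hz).le,
    fun z hz => iff_of_false (hnorm z hz).ne (hpos z hz).ne'⟩, hz₀e⟩

theorem exists_isBallChart_of_ne_zero {z₀ : EuclideanSpace ℝ (Fin q)} (hz₀ : z₀ ≠ 0) :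
    ∃ e, IsBallChart e ∧ z₀ ∈ e.source := by
  obtain ⟨i₀, hi₀⟩ : ∃ i, z₀ i ≠ 0 := by
    by_contra! hall
    exact hz₀ (by ext i; exact hall i)
  obtain ⟨e, he, hze, heq⟩ := exists_sphere_coordinates (Equiv.swap 0 i₀) (r := 0)
    (by rwa [Equiv.swap_apply_left]) 0
  refine ⟨e, ⟨he, fun z _ => ?_, fun z _ => ?_⟩, hze⟩
  · rw [heq, if_pos rfl, sub_nonneg, sq_le_one_iff₀ (norm_nonneg z)]
  · rw [heq, if_pos rfl, sub_eq_zero, eq_comm (a := (1 : ℝ)),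
      pow_eq_one_iff_of_nonneg (norm_nonneg z) two_ne_zero]

theorem exists_isBallChart (z₀ : EuclideanSpace ℝ (Fin q)) :
    ∃ e, IsBallChart e ∧ z₀ ∈ e.source := by
  rcases eq_or_ne z₀ 0 with rfl | hz₀
  · exact exists_isBallChart_of_norm_lt_one (by simp)
  · exact exists_isBallChart_of_ne_zero hz₀

namespace IsBallChart

variable {e : OpenPartialHomeomorph (EuclideanSpace ℝ (Fin q)) (EuclideanSpace ℝ (Fin q))}

theorem contDiffOn (he : IsBallChart e) : ContDiffOn ℝ ∞ e e.source :=
  contMDiffOn_iff_contDiffOn.1 (contMDiffOn_of_mem_contDiffGroupoid he.mem_groupoid)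

theorem contDiffOn_symm (he : IsBallChart e) : ContDiffOn ℝ ∞ e.symm e.target :=
  contMDiffOn_iff_contDiffOn.1 (contMDiffOn_of_mem_contDiffGroupoid
    ((contDiffGroupoid ∞ (𝓡 q)).symm he.mem_groupoid))

end IsBallChart

namespace IsDiskEmbedding

variable {W : Type*} [TopologicalSpace W] {ε : W → EuclideanSpace ℝ (Fin q)}
  {e : OpenPartialHomeomorph (EuclideanSpace ℝ (Fin q)) (EuclideanSpace ℝ (Fin q))}

theorem val_symm_apply (hε : IsDiskEmbedding ε) (he : IsBallChart e) {w : W}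
    (hw : ε w ∈ e.source) : ((𝓡∂ q).symm (e (ε w))).1 = e (ε w) :=
  (𝓡∂ q).right_inv (by
    rw [range_modelWithCornersEuclideanHalfSpace]
    exact (he.norm_le_one_iff _ hw).1 (hε.norm_le_one w))

theorem apply_inverse_symm (hε : IsDiskEmbedding ε) (he : IsBallChart e)
    {x : EuclideanHalfSpace q} (hx : x.1 ∈ e.target) :
    ε (hε.inverse (e.symm x.1)) = e.symm x.1 :=
  hε.apply_inverse (by
    rw [he.norm_le_one_iff _ (e.map_target hx), e.right_inv hx]
    exact x.2)

/-- The chart on the source of an embedding onto the ball that is induced by coordinates adapted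
to the ball. -/
noncomputable def halfChart (hε : IsDiskEmbedding ε) (he : IsBallChart e) :
    OpenPartialHomeomorph W (EuclideanHalfSpace q) where
  toFun w := (𝓡∂ q).symm (e (ε w))
  invFun x := hε.inverse (e.symm x.1)
  source := ε ⁻¹' e.source
  target := Subtype.val ⁻¹' e.target
  map_source' w hw := by
    rw [Set.mem_preimage, hε.val_symm_apply he hw]
    exact e.map_source hw
  map_target' x hx := by
    rw [Set.mem_preimage, hε.apply_inverse_symm he hx]
    exact e.map_target hx
  left_inv' w hw := by rw [hε.val_symm_apply he hw, e.left_inv hw, hε.inverse_apply]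
  right_inv' x hx := by
    rw [hε.apply_inverse_symm he hx, e.right_inv hx]
    exact (𝓡∂ q).left_inv x
  open_source := e.open_source.preimage hε.continuous
  open_target := e.open_target.preimage continuous_subtype_val
  continuousOn_toFun := (𝓡∂ q).continuous_symm.comp_continuousOn
    (e.continuousOn.comp hε.continuous.continuousOn fun _ hw => hw)
  continuousOn_invFun := by
    rw [hε.continuousOn_iff]
    exact (e.continuousOn_symm.comp continuous_subtype_val.continuousOn fun _ hx => hx).congr
      fun x hx => hε.apply_inverse_symm he hx

theorem halfChart_val (hε : IsDiskEmbedding ε) (he : IsBallChart e) {w : W}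
    (hw : ε w ∈ e.source) : (hε.halfChart he w).1 = e (ε w) :=
  hε.val_symm_apply he hw

theorem halfChart_symm_trans_apply (hε : IsDiskEmbedding ε) (he : IsBallChart e)
    {e' : OpenPartialHomeomorph (EuclideanSpace ℝ (Fin q)) (EuclideanSpace ℝ (Fin q))}
    (he' : IsBallChart e') {x : EuclideanSpace ℝ (Fin q)}
    (hx : x ∈ (𝓡∂ q).symm ⁻¹' ((hε.halfChart he).symm ≫ₕ hε.halfChart he').source ∩
      Set.range (𝓡∂ q)) :
    x ∈ e.target ∧ e.symm x ∈ e'.source ∧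
      ((𝓡∂ q) ∘ ((hε.halfChart he).symm ≫ₕ hε.halfChart he') ∘ (𝓡∂ q).symm) x
        = e' (e.symm x) := by
  have hval : ((𝓡∂ q).symm x).1 = x := (𝓡∂ q).right_inv hx.2
  have hsource : (𝓡∂ q).symm x ∈ ((hε.halfChart he).symm ≫ₕ hε.halfChart he').source := hx.1
  rw [OpenPartialHomeomorph.trans_source] at hsource
  have hxe : ((𝓡∂ q).symm x).1 ∈ e.target := hsource.1
  have hsymm : ε ((hε.halfChart he).symm ((𝓡∂ q).symm x)) = e.symm x :=
    (hε.apply_inverse_symm he hxe).trans (congrArg e.symm hval)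
  have hxe' : ε ((hε.halfChart he).symm ((𝓡∂ q).symm x)) ∈ e'.source := hsource.2
  refine ⟨hval ▸ hxe, hsymm ▸ hxe', ?_⟩
  rw [← hsymm]
  exact hε.halfChart_val he' hxe'

/-- The atlas induced by an embedding onto the ball. -/
@[reducible]
noncomputable def chartedSpace (hε : IsDiskEmbedding ε) :
    ChartedSpace (EuclideanHalfSpace q) W where
  atlas := Set.range fun w => hε.halfChart (exists_isBallChart (ε w)).choose_spec.1
  chartAt w := hε.halfChart (exists_isBallChart (ε w)).choose_spec.1
  mem_chart_source w := (exists_isBallChart (ε w)).choose_spec.2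
  chart_mem_atlas w := Set.mem_range_self w

theorem exists_extChartAt_eq (hε : IsDiskEmbedding ε) (w : W) :
    letI := hε.chartedSpace
    ∃ e : OpenPartialHomeomorph (EuclideanSpace ℝ (Fin q)) (EuclideanSpace ℝ (Fin q)),
      IsBallChart e ∧ ε w ∈ e.source ∧ (extChartAt (𝓡∂ q) w).source = ε ⁻¹' e.source ∧
      ∀ w', ε w' ∈ e.source → extChartAt (𝓡∂ q) w w' = e (ε w') := by
  let _ := hε.chartedSpace
  have he := (exists_isBallChart (ε w)).choose_spec
  exact ⟨_, he.1, he.2, extChartAt_source (𝓡∂ q) w, fun w' hw' => hε.halfChart_val he.1 hw'⟩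

theorem isManifold (hε : IsDiskEmbedding ε) :
    letI := hε.chartedSpace
    IsManifold (𝓡∂ q) ∞ W := by
  let _ := hε.chartedSpace
  refine isManifold_of_contDiffOn _ _ _ ?_
  rintro _ _ ⟨w, rfl⟩ ⟨w', rfl⟩
  refine ContDiffOn.congr ?_ fun x hx => (hε.halfChart_symm_trans_apply _ _ hx).2.2
  exact (exists_isBallChart (ε w')).choose_spec.1.contDiffOn.comp
    ((exists_isBallChart (ε w)).choose_spec.1.contDiffOn_symm.mono
      fun x hx => (hε.halfChart_symm_trans_apply _ _ hx).1)
    fun x hx => (hε.halfChart_symm_trans_apply _ _ hx).2.1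

theorem mem_boundary_iff (hε : IsDiskEmbedding ε) (w : W) :
    letI := hε.chartedSpace
    w ∈ (𝓡∂ q).boundary W ↔ ‖ε w‖ = 1 := by
  let _ := hε.chartedSpace
  obtain ⟨e, he, hw, -, hext⟩ := hε.exists_extChartAt_eq w
  change (𝓡∂ q).IsBoundaryPoint w ↔ _
  rw [ModelWithCorners.isBoundaryPoint_iff, frontier_range_modelWithCornersEuclideanHalfSpace,
    he.norm_eq_one_iff _ hw, hext w hw]
  exact eq_comm

theorem contMDiff (hε : IsDiskEmbedding ε) :
    letI := hε.chartedSpace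
    ContMDiff (𝓡∂ q) (𝓡 q) ∞ ε := by
  let _ := hε.chartedSpace
  have := hε.isManifold
  intro w
  obtain ⟨e, he, hw, hsource, hext⟩ := hε.exists_extChartAt_eq w
  have hcomp : ContMDiffOn (𝓡∂ q) (𝓡 q) ∞ (fun w' => e.symm (extChartAt (𝓡∂ q) w w'))
      (ε ⁻¹' e.source) := by
    refine he.contDiffOn_symm.contMDiffOn.comp (s := ε ⁻¹' e.source) ?_ fun w' hw' => ?_
    · rw [← hsource, extChartAt_source]
      exact contMDiffOn_extChartAt
    · rw [Set.mem_preimage, hext w' hw']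
      exact e.map_source hw'
  refine (hcomp.congr fun w' hw' => ?_).contMDiffAt
    ((e.open_source.preimage hε.continuous).mem_nhds hw)
  rw [hext w' hw', e.left_inv hw']

theorem contMDiffOn_inverse (hε : IsDiskEmbedding ε) :
    letI := hε.chartedSpace
    ContMDiffOn (𝓡 q) (𝓡∂ q) ∞ hε.inverse (Metric.closedBall 0 1) := by
  let _ := hε.chartedSpace
  have := hε.isManifold
  intro z hz
  obtain ⟨w, rfl⟩ : z ∈ Set.range ε := hε.range_eq ▸ hz
  obtain ⟨e, he, hw, hsource, hext⟩ := hε.exists_extChartAt_eq w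
  have hmem : ∀ z ∈ Metric.closedBall 0 1 ∩ e.source, ∃ w' ∈ (extChartAt (𝓡∂ q) w).source,
      ε w' = z ∧ extChartAt (𝓡∂ q) w w' = e z := by
    rintro z ⟨hz, hze⟩
    obtain ⟨w', rfl⟩ : z ∈ Set.range ε := hε.range_eq ▸ hz
    exact ⟨w', hsource ▸ hze, rfl, hext w' hze⟩
  have hcomp : ContMDiffOn (𝓡 q) (𝓡∂ q) ∞ (fun z => (extChartAt (𝓡∂ q) w).symm (e z))
      (Metric.closedBall 0 1 ∩ e.source) := by
    refine (contMDiffOn_extChartAt_symm w).comp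
      (he.contDiffOn.contMDiffOn.mono Set.inter_subset_right) fun z hz => ?_
    obtain ⟨w', hw', -, hz'⟩ := hmem z hz
    rw [Set.mem_preimage, ← hz']
    exact (extChartAt (𝓡∂ q) w).map_source hw'
  refine (hcomp.congr (fun z hz => ?_) _ ⟨hz, hw⟩).mono_of_mem_nhdsWithin
    (Filter.inter_mem self_mem_nhdsWithin
      (mem_nhdsWithin_of_mem_nhds (e.open_source.mem_nhds hw)))
  obtain ⟨w', hw', rfl, hz'⟩ := hmem z hz
  rw [← hz', (extChartAt (𝓡∂ q) w).left_inv hw', hε.inverse_apply]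

theorem isDiffeoOntoDisk (hε : IsDiskEmbedding ε) :
    letI := hε.chartedSpace
    IsDiffeoOntoDisk ε :=
  letI := hε.chartedSpace
  ⟨hε.range_eq, hε.contMDiff, hε.inverse, hε.contMDiffOn_inverse, hε.inverse_apply⟩

end IsDiskEmbedding

end Disk

section Fibers

variable {X Y : Type*} [TopologicalSpace X]

theorem isPreconnected_preimage_of_isClosedMap [TopologicalSpace Y] {k : X → Y}
    (hk : IsClosedMap k) (hfib : ∀ y, IsPreconnected (k ⁻¹' {y})) {S : Set Y}
    (hS : IsPreconnected S) (hSk : S ⊆ Set.range k) : IsPreconnected (k ⁻¹' S) := by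
  rw [isPreconnected_closed_iff]
  rintro t t' ht ht' hcov ⟨x, hxS, hxt⟩ ⟨x', hxS', hxt'⟩
  obtain ⟨y, hyS, ⟨z, hzt, rfl⟩, ⟨z', hzt', hzz'⟩⟩ := isPreconnected_closed_iff.1 hS (k '' t)
    (k '' t') (hk t ht) (hk t' ht')
    (fun y hy => by
      obtain ⟨x, rfl⟩ := hSk hy
      exact (hcov hy).imp (Set.mem_image_of_mem k) (Set.mem_image_of_mem k))
    ⟨k x, hxS, x, hxt, rfl⟩ ⟨k x', hxS', x', hxt', rfl⟩
  have hsub : k ⁻¹' {k z} ⊆ k ⁻¹' S := Set.preimage_mono (Set.singleton_subset_iff.2 hyS)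
  obtain ⟨a, ha, hat⟩ := isPreconnected_closed_iff.1 (hfib (k z)) t t' ht ht'
    (hsub.trans hcov) ⟨z, rfl, hzt⟩ ⟨z', hzz', hzt'⟩
  exact ⟨a, hsub ha, hat⟩

theorem steinQuot_surjective (k : X → Y) : Function.Surjective (steinQuot k) :=
  Quotient.mk_surjective

theorem continuous_steinQuot (k : X → Y) : Continuous (steinQuot k) := continuous_quotient_mk'

theorem steinBar_comp_steinQuot (k : X → Y) : steinBar k ∘ steinQuot k = k := rfl

theorem range_steinBar (k : X → Y) : Set.range (steinBar k) = Set.range k := by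
  rw [← (steinQuot_surjective k).range_comp, steinBar_comp_steinQuot]

theorem isPreconnected_preimage_steinQuot (k : X → Y) (w : SteinSpace k) :
    IsPreconnected (steinQuot k ⁻¹' {w}) := by
  obtain ⟨x, rfl⟩ := steinQuot_surjective k w
  have heq : steinQuot k ⁻¹' {steinQuot k x} = connectedComponentIn (k ⁻¹' {k x}) x := by
    ext x'
    rw [Set.mem_preimage, Set.mem_singleton_iff, eq_comm]
    refine Quotient.eq.trans ⟨fun h => h.2, fun h => ⟨?_, h⟩⟩
    exact (connectedComponentIn_subset _ _ h).symm
  rw [heq]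
  exact isPreconnected_connectedComponentIn

theorem isEmbedding_steinBar [TopologicalSpace Y] [CompactSpace X] [T2Space Y] {k : X → Y}
    (hk : Continuous k) (hfib : ∀ y, IsPreconnected (k ⁻¹' {y})) :
    Topology.IsEmbedding (steinBar k) := by
  have hcont : Continuous (steinBar k) := hk.quotient_lift _
  have : CompactSpace (SteinSpace k) :=
    ⟨by rw [← (steinQuot_surjective k).range_eq]; exact isCompact_range (continuous_steinQuot k)⟩
  have hinj : Function.Injective (steinBar k) := by
    intro w w' h
    obtain ⟨x, rfl⟩ := steinQuot_surjective k w
    obtain ⟨x', rfl⟩ := steinQuot_surjective k w'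
    have hx : k x = k x' := h
    refine Quotient.sound ⟨hx, ?_⟩
    exact (hfib (k x)).subset_connectedComponentIn (x := x) rfl subset_rfl hx.symm
  exact (hcont.isClosedEmbedding hinj).isEmbedding

end Fibers

section Differential

variable {n p q : ℕ} {M : Type*} [TopologicalSpace M] [ChartedSpace (EuclideanSpace ℝ (Fin n)) M]

theorem hasFDerivAt_comp_symm_of_mem_maximalAtlas
    {k : M → EuclideanSpace ℝ (Fin p)} {x : M} (hk : MDifferentiableAt (𝓡 n) (𝓡 p) k x)
    {φ : OpenPartialHomeomorph M (EuclideanSpace ℝ (Fin n))}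
    (hφ : φ ∈ IsManifold.maximalAtlas (𝓡 n) ∞ M) (hx : x ∈ φ.source) :
    HasFDerivAt (k ∘ φ.symm) (fderiv ℝ (k ∘ φ.symm) (φ x)) (φ x) := by
  refine DifferentiableAt.hasFDerivAt ?_
  rw [← mdifferentiableAt_iff_differentiableAt]
  exact MDifferentiableAt.comp _ (by rwa [φ.left_inv hx])
    ((contMDiffAt_symm_of_mem_maximalAtlas hφ (φ.map_source hx)).mdifferentiableAt (by simp))

theorem surjective_mfderiv_iff_of_mem_maximalAtlas
    {k : M → EuclideanSpace ℝ (Fin p)} {x : M} (hk : MDifferentiableAt (𝓡 n) (𝓡 p) k x)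
    {φ : OpenPartialHomeomorph M (EuclideanSpace ℝ (Fin n))}
    (hφ : φ ∈ IsManifold.maximalAtlas (𝓡 n) ∞ M) (hx : x ∈ φ.source) :
    Function.Surjective (mfderiv (𝓡 n) (𝓡 p) k x) ↔
      Function.Surjective (fderiv ℝ (k ∘ φ.symm) (φ x)) := by
  have hφd : φ.MDifferentiable (𝓡 n) (𝓡 n) :=
    ⟨(contMDiffOn_of_mem_maximalAtlas hφ).mdifferentiableOn (by simp),
      (contMDiffOn_symm_of_mem_maximalAtlas hφ).mdifferentiableOn (by simp)⟩
  have hcomp : HasMFDerivAt (𝓡 n) (𝓡 p) ((k ∘ φ.symm) ∘ φ) x _ :=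
    (hasFDerivAt_comp_symm_of_mem_maximalAtlas hk hφ hx).hasMFDerivAt.comp x
      (hφd.mdifferentiableAt hx).hasMFDerivAt
  have hkx : mfderiv (𝓡 n) (𝓡 p) k x = _ := (hcomp.congr_of_eventuallyEq (by
    filter_upwards [φ.open_source.mem_nhds hx] with x' hx'
    simp only [Function.comp_apply, φ.left_inv hx'])).mfderiv
  rw [hkx]
  exact (hφd.mfderiv_surjective hx).of_comp_iff _

theorem mfderiv_comp_apply_of_contDiffOn {h : M → EuclideanSpace ℝ (Fin p)}
    {g : EuclideanSpace ℝ (Fin p) → EuclideanSpace ℝ (Fin q)} {s : Set (EuclideanSpace ℝ (Fin p))}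
    {x : M} (hh : MDifferentiableAt (𝓡 n) (𝓡 p) h x) (hg : ContDiffOn ℝ ∞ g s)
    (hhs : ∀ x, h x ∈ s) (a : EuclideanSpace ℝ (Fin n)) :
    mfderiv (𝓡 n) (𝓡 q) (g ∘ h) x a = fderivWithin ℝ g s (h x) (mfderiv (𝓡 n) (𝓡 p) h x a) := by
  have hgx := (hg.differentiableOn (by simp) (h x) (hhs x)).hasFDerivWithinAt.hasMFDerivWithinAt
  have hcomp := hasMFDerivWithinAt_univ.1
    (hgx.comp x hh.hasMFDerivAt.hasMFDerivWithinAt (s := Set.univ) fun x' _ => hhs x')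
  rw [hcomp.mfderiv]
  rfl

theorem surjective_mfderiv_of_comp {h : M → EuclideanSpace ℝ (Fin p)}
    {g : EuclideanSpace ℝ (Fin p) → EuclideanSpace ℝ (Fin q)} {s : Set (EuclideanSpace ℝ (Fin p))}
    {x : M} (hh : MDifferentiableAt (𝓡 n) (𝓡 p) h x) (hg : ContDiffOn ℝ ∞ g s)
    (hhs : ∀ x, h x ∈ s) (hinj : Function.Injective (fderivWithin ℝ g s (h x)))
    (hsurj : Function.Surjective (mfderiv (𝓡 n) (𝓡 q) (g ∘ h) x)) :
    Function.Surjective (mfderiv (𝓡 n) (𝓡 p) h x) := fun b => by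
  obtain ⟨a, ha⟩ := hsurj (fderivWithin ℝ g s (h x) b)
  exact ⟨a, hinj ((mfderiv_comp_apply_of_contDiffOn hh hg hhs a).symm.trans ha)⟩

theorem inner_eq_zero_of_isLocalMax_norm {V F : Type*} [NormedAddCommGroup V] [NormedSpace ℝ V]
    [NormedAddCommGroup F] [InnerProductSpace ℝ F] {η : V → F} {η' : V →L[ℝ] F} {v₀ : V}
    (hη : HasFDerivAt η η' v₀) (hmax : IsLocalMax (fun v => ‖η v‖) v₀) (a : V) :
    inner ℝ (η v₀) (η' a) = 0 := by
  have hmax_sq : IsLocalMax (fun v => ‖η v‖ ^ 2) v₀ :=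
    hmax.mono fun v hv => pow_le_pow_left₀ (norm_nonneg _) hv 2
  simpa using congrArg (fun L => L a) (hmax_sq.hasFDerivAt_eq_zero hη.norm_sq)

theorem norm_lt_one_of_surjective_mfderiv [IsManifold (𝓡 n) ∞ M]
    {k : M → EuclideanSpace ℝ (Fin p)} {x : M} (hk : MDifferentiableAt (𝓡 n) (𝓡 p) k x)
    (hle : ∀ x, ‖k x‖ ≤ 1) (hx : Function.Surjective (mfderiv (𝓡 n) (𝓡 p) k x)) : ‖k x‖ < 1 := by
  refine (hle x).lt_of_ne fun hkx => ?_
  have hφ := IsManifold.chart_mem_maximalAtlas (I := 𝓡 n) (n := ∞) x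
  have hxφ := mem_chart_source (EuclideanSpace ℝ (Fin n)) x
  set φ := chartAt (EuclideanSpace ℝ (Fin n)) x
  obtain ⟨a, ha⟩ := (surjective_mfderiv_iff_of_mem_maximalAtlas hk hφ hxφ).1 hx (k x)
  have hsymm : (k ∘ φ.symm) (φ x) = k x := congrArg k (φ.left_inv hxφ)
  have hortho := inner_eq_zero_of_isLocalMax_norm
    (hasFDerivAt_comp_symm_of_mem_maximalAtlas hk hφ hxφ)
    (Filter.Eventually.of_forall fun v => by
      rw [← hsymm] at hkx
      exact (hle _).trans_eq hkx.symm) a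
  rw [ha, hsymm, real_inner_self_eq_norm_sq, hkx] at hortho
  norm_num at hortho

end Differential

section Standard

variable {n p : ℕ} [NeZero p]

namespace IsDiffeoOntoDisk

variable {W : Type*} [TopologicalSpace W] [ChartedSpace (EuclideanHalfSpace p) W]
  {Φ : W → EuclideanSpace ℝ (Fin p)} {Ψ : EuclideanSpace ℝ (Fin p) → W}

theorem mem_closedBall (hΦ : IsDiffeoOntoDisk Φ) (w : W) : Φ w ∈ Metric.closedBall 0 1 :=
  hΦ.range_eq ▸ Set.mem_range_self w

theorem mfderivWithin_mfderiv_apply (hΦ : IsDiffeoOntoDisk Φ)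
    (hΨ : ContMDiffOn (𝓡 p) (𝓡∂ p) ∞ Ψ (Metric.closedBall 0 1)) (hΨΦ : ∀ w, Ψ (Φ w) = w) (w : W)
    (a : EuclideanSpace ℝ (Fin p)) :
    mfderivWithin (𝓡 p) (𝓡∂ p) Ψ (Metric.closedBall 0 1) (Φ w)
      (mfderiv (𝓡∂ p) (𝓡 p) Φ w a) = a := by
  have hΨw := (hΨ (Φ w) (hΦ.mem_closedBall w)).mdifferentiableWithinAt (by simp)
  have hΦw := (hΦ.smooth w).mdifferentiableAt (by simp)
  have hcomp := hasMFDerivWithinAt_univ.1 (hΨw.hasMFDerivWithinAt.comp w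
    hΦw.hasMFDerivAt.hasMFDerivWithinAt (s := Set.univ) fun w' _ => hΦ.mem_closedBall w')
  rw [show Ψ ∘ Φ = id from funext hΨΦ] at hcomp
  exact congrArg (fun L : EuclideanSpace ℝ (Fin p) →L[ℝ] EuclideanSpace ℝ (Fin p) => L a)
    (hasMFDerivAt_unique hcomp (hasMFDerivAt_id w))

theorem injective_mfderiv (hΦ : IsDiffeoOntoDisk Φ) (w : W) :
    Function.Injective (mfderiv (𝓡∂ p) (𝓡 p) Φ w) := by
  obtain ⟨Ψ, hΨ, hΨΦ⟩ := hΦ.smooth_inverse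
  exact Function.LeftInverse.injective (hΦ.mfderivWithin_mfderiv_apply hΨ hΨΦ w)

theorem injective_fderivWithin_comp_inverse (hΦ : IsDiffeoOntoDisk Φ)
    (hΨ : ContMDiffOn (𝓡 p) (𝓡∂ p) ∞ Ψ (Metric.closedBall 0 1)) (hΨΦ : ∀ w, Ψ (Φ w) = w)
    {b : W → EuclideanSpace ℝ (Fin p)} (hb : ContMDiff (𝓡∂ p) (𝓡 p) ∞ b)
    (hinj : ∀ w, Function.Injective (mfderiv (𝓡∂ p) (𝓡 p) b w)) {y : EuclideanSpace ℝ (Fin p)}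
    (hy : y ∈ Metric.closedBall 0 1) :
    Function.Injective (fderivWithin ℝ (b ∘ Ψ) (Metric.closedBall 0 1) y) := by
  obtain ⟨w, rfl⟩ : y ∈ Set.range Φ := hΦ.range_eq ▸ hy
  let Ψ' : EuclideanSpace ℝ (Fin p) →L[ℝ] EuclideanSpace ℝ (Fin p) :=
    mfderivWithin (𝓡 p) (𝓡∂ p) Ψ (Metric.closedBall 0 1) (Φ w)
  have hΨ'_inj : Function.Injective Ψ' := LinearMap.injective_iff_surjective.2
    (Function.LeftInverse.surjective (hΦ.mfderivWithin_mfderiv_apply hΨ hΨΦ w))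
  have hcomp := (hb.mdifferentiableAt (by simp)).hasMFDerivAt.comp_hasMFDerivWithinAt (Φ w)
    ((hΨ _ hy).mdifferentiableWithinAt (by simp)).hasMFDerivWithinAt
  rw [← mfderivWithin_eq_fderivWithin,
    hcomp.mfderivWithin ((uniqueDiffOn_closedBall _ hy).uniqueMDiffWithinAt)]
  exact (hinj (Ψ (Φ w))).comp hΨ'_inj

theorem norm_eq_one_of_mem_boundary (hΦ : IsDiffeoOntoDisk Φ) {w : W}
    (hw : w ∈ (𝓡∂ p).boundary W) : ‖Φ w‖ = 1 := by
  obtain ⟨Ψ, hΨ, hΨΦ⟩ := hΦ.smooth_inverse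
  refine (mem_closedBall_zero_iff.1 (hΦ.mem_closedBall w)).eq_of_not_lt fun hlt => ?_
  have hnhds : Metric.closedBall (0 : EuclideanSpace ℝ (Fin p)) 1 ∈ 𝓝 (Φ w) :=
    Filter.mem_of_superset (Metric.isOpen_ball.mem_nhds (mem_ball_zero_iff.2 hlt))
      Metric.ball_subset_closedBall
  have hleft := hΦ.mfderivWithin_mfderiv_apply hΨ hΨΦ w
  rw [mfderivWithin_of_mem_nhds hnhds] at hleft
  have hinterior := ((hΨ.contMDiffAt hnhds).mdifferentiableAt
    (by simp)).isInteriorPoint_of_surjective_mfderiv (Function.LeftInverse.surjective hleft)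
      BoundarylessManifold.isInteriorPoint
  rw [hΨΦ, ModelWithCorners.isInteriorPoint_iff_not_isBoundaryPoint] at hinterior
  exact hinterior hw

end IsDiffeoOntoDisk

variable {M : Type*} [TopologicalSpace M] [ChartedSpace (EuclideanSpace ℝ (Fin n)) M]

theorem exists_isSteinSmoothStructure [CompactSpace M] {k : M → EuclideanSpace ℝ (Fin p)}
    (hk : ContMDiff (𝓡 n) (𝓡 p) ∞ k) (hrange : Set.range k = Metric.closedBall 0 1)
    (hfib : ∀ y, IsPreconnected (k ⁻¹' {y})) (hsing : ∀ x, x ∈ singularLocus n k ↔ ‖k x‖ = 1) :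
    ∃ _ : ChartedSpace (EuclideanHalfSpace p) (SteinSpace k),
      IsSteinSmoothStructure n k ∧ ∃ Φ : SteinSpace k → EuclideanSpace ℝ (Fin p),
        IsDiffeoOntoDisk Φ := by
  have hdisk : IsDiskEmbedding (steinBar k) :=
    ⟨isEmbedding_steinBar hk.continuous hfib, (range_steinBar k).trans hrange⟩
  let _ := hdisk.chartedSpace
  refine ⟨hdisk.chartedSpace, ⟨hdisk.isManifold, ?_, ?_, hdisk.contMDiff,
    hdisk.isDiffeoOntoDisk.injective_mfderiv⟩, steinBar k, hdisk.isDiffeoOntoDisk⟩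
  · have hquot : steinQuot k = hdisk.inverse ∘ k :=
      funext fun x => (hdisk.inverse_apply (steinQuot k x)).symm
    rw [hquot]
    exact hdisk.contMDiffOn_inverse.comp_contMDiff hk fun x => hrange ▸ Set.mem_range_self x
  · ext x
    rw [Set.mem_preimage, hdisk.mem_boundary_iff, hsing]
    rfl

end Standard

section DiskFactorization

variable {n p : ℕ} {M : Type*} [TopologicalSpace M] [ChartedSpace (EuclideanSpace ℝ (Fin n)) M]

variable (n) in
/-- A factorization `f = g ∘ h` through the closed unit ball as in the Stein factorization of a
standard special generic map: `h` is a quotient map with connected fibres, `g` is an immersion of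
the ball, and the sphere corresponds to the singular points. Values of `g` outside the ball are
irrelevant. -/
structure IsDiskFactorization (f h : M → EuclideanSpace ℝ (Fin p))
    (g : EuclideanSpace ℝ (Fin p) → EuclideanSpace ℝ (Fin p)) : Prop where
  eq_comp : f = g ∘ h
  contMDiff : ContMDiff (𝓡 n) (𝓡 p) ∞ h
  range_eq : Set.range h = Metric.closedBall 0 1
  isPreconnected_preimage : ∀ y, IsPreconnected (h ⁻¹' {y})
  contDiffOn : ContDiffOn ℝ ∞ g (Metric.closedBall 0 1)
  injective_fderivWithin : ∀ y ∈ Metric.closedBall 0 1,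
    Function.Injective (fderivWithin ℝ g (Metric.closedBall 0 1) y)
  mem_singularLocus_iff : ∀ x, x ∈ singularLocus n f ↔ ‖h x‖ = 1

theorem IsDiskFactorization.norm_le_one {f h : M → EuclideanSpace ℝ (Fin p)}
    {g : EuclideanSpace ℝ (Fin p) → EuclideanSpace ℝ (Fin p)} (hfac : IsDiskFactorization n f h g)
    (x : M) : ‖h x‖ ≤ 1 :=
  mem_closedBall_zero_iff.1 (hfac.range_eq ▸ Set.mem_range_self x)

theorem exists_isDiskFactorization [NeZero p] [IsManifold (𝓡 n) ∞ M]
    {f : M → EuclideanSpace ℝ (Fin p)}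
    [ChartedSpace (EuclideanHalfSpace p) (SteinSpace f)] (hW : IsSteinSmoothStructure n f)
    {Φ : SteinSpace f → EuclideanSpace ℝ (Fin p)} (hΦ : IsDiffeoOntoDisk Φ) :
    ∃ g, IsDiskFactorization n f (Φ ∘ steinQuot f) g := by
  obtain ⟨Ψ, hΨ, hΨΦ⟩ := hΦ.smooth_inverse
  have hh : ContMDiff (𝓡 n) (𝓡 p) ∞ (Φ ∘ steinQuot f) := hΦ.smooth.comp hW.smooth_quot
  have hg : ContDiffOn ℝ ∞ (steinBar f ∘ Ψ) (Metric.closedBall 0 1) :=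
    contMDiffOn_iff_contDiffOn.1 (hW.smooth_bar.comp_contMDiffOn hΨ)
  have hfg : f = (steinBar f ∘ Ψ) ∘ Φ ∘ steinQuot f := by
    ext1 x
    simp only [Function.comp_apply, hΨΦ]
    rfl
  have hinj : ∀ y ∈ Metric.closedBall 0 1,
      Function.Injective (fderivWithin ℝ (steinBar f ∘ Ψ) (Metric.closedBall 0 1) y) := fun y =>
    hΦ.injective_fderivWithin_comp_inverse hΨ hΨΦ hW.smooth_bar hW.injective_mfderiv_bar
  refine ⟨_, hfg, hh, ?_, fun y => ?_, hg, hinj, fun x => ⟨fun hx => ?_, fun hx hsurj => ?_⟩⟩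
  · rw [(steinQuot_surjective f).range_comp, hΦ.range_eq]
  · rw [Set.preimage_comp]
    exact (Set.subsingleton_singleton.preimage
      (Function.LeftInverse.injective (g := Ψ) (f := Φ) hΨΦ)).induction_on
      (p := fun s => IsPreconnected (steinQuot f ⁻¹' s)) isPreconnected_empty
      (isPreconnected_preimage_steinQuot f)
  · rw [← hW.preimage_boundary] at hx
    exact hΦ.norm_eq_one_of_mem_boundary hx
  · refine (norm_lt_one_of_surjective_mfderiv (hh.mdifferentiableAt (by simp))
      (fun x => mem_closedBall_zero_iff.1 (hΦ.mem_closedBall _))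
      (surjective_mfderiv_of_comp (hh.mdifferentiableAt (by simp)) hg (fun x => hΦ.mem_closedBall _)
        (hinj _ (hΦ.mem_closedBall _)) ?_)).ne hx
    rw [← hfg]
    exact hsurj

end DiskFactorization

section Fold

variable {n p : ℕ}

/-- The sum of the squares of the coordinates of `ℝ^n` from the `p`-th one on. -/
def tailSq (p : ℕ) {n : ℕ} (v : EuclideanSpace ℝ (Fin n)) : ℝ :=
  ∑ j : Fin n with p ≤ j.val + 1, v j ^ 2

theorem tailSq_eq_zero_iff {v : EuclideanSpace ℝ (Fin n)} :
    tailSq p v = 0 ↔ ∀ j : Fin n, p ≤ (j : ℕ) + 1 → v j = 0 := by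
  rw [tailSq, Finset.sum_eq_zero_iff_of_nonneg fun j _ => sq_nonneg _]
  simp

theorem tailSq_nonneg (v : EuclideanSpace ℝ (Fin n)) : 0 ≤ tailSq p v :=
  Finset.sum_nonneg fun _ _ => sq_nonneg _

theorem tailSq_smul (t : ℝ) (v : EuclideanSpace ℝ (Fin n)) :
    tailSq p (t • v) = t ^ 2 * tailSq p v := by
  simp only [tailSq, PiLp.smul_apply, smul_eq_mul, mul_pow, Finset.mul_sum]

theorem frequently_tailSq_pos [NeZero p] (hpn : p ≤ n) :
    ∃ᶠ v : EuclideanSpace ℝ (Fin n) in 𝓝 0, 0 < tailSq p v := by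
  have hp := NeZero.one_le (n := p)
  let v : EuclideanSpace ℝ (Fin n) := EuclideanSpace.single ⟨n - 1, by omega⟩ 1
  have hv : 0 < tailSq p v := (tailSq_nonneg v).lt_of_ne fun h0 => by
    have := tailSq_eq_zero_iff.1 h0.symm ⟨n - 1, by omega⟩ (by simp only; omega)
    simp [v] at this
  have htend : Filter.Tendsto (fun t : ℝ => t • v) (𝓝[≠] 0) (𝓝 0) :=
    tendsto_nhdsWithin_of_tendsto_nhds (Continuous.tendsto' (by fun_prop) _ _ (zero_smul ℝ v))
  refine htend.frequently (Filter.Eventually.frequently ?_)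
  filter_upwards [self_mem_nhdsWithin] with t ht
  rw [tailSq_smul]
  exact mul_pos (sq_pos_of_ne_zero ht) hv

theorem hasFDerivAt_tailSq (v : EuclideanSpace ℝ (Fin n)) :
    HasFDerivAt (tailSq p) (∑ j : Fin n with p ≤ j.val + 1,
      (2 * v j) • (EuclideanSpace.proj j : EuclideanSpace ℝ (Fin n) →L[ℝ] ℝ)) v :=
  HasFDerivAt.fun_sum fun j _ => by
    simpa using ((EuclideanSpace.proj (𝕜 := ℝ) j).hasFDerivAt (x := v)).pow 2

/-- The definite fold map `(x', x'') ↦ (x', σ ‖x''‖²)` with `x' ∈ ℝ^{p-1}`. -/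
def foldMap (hpn : p ≤ n) (σ : ℝ) (v : EuclideanSpace ℝ (Fin n)) : EuclideanSpace ℝ (Fin p) :=
  WithLp.toLp 2 fun i => if (i : ℕ) + 1 < p then v (Fin.castLE hpn i) else σ * tailSq p v

theorem foldMap_apply_of_lt (hpn : p ≤ n) (σ : ℝ) (v : EuclideanSpace ℝ (Fin n)) {i : Fin p}
    (hi : (i : ℕ) + 1 < p) : foldMap hpn σ v i = v (Fin.castLE hpn i) :=
  if_pos hi

theorem foldMap_apply_top [NeZero p] (hpn : p ≤ n) (σ : ℝ) (v : EuclideanSpace ℝ (Fin n)) :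
    foldMap hpn σ v ⊤ = σ * tailSq p v := by
  have := NeZero.one_le (n := p)
  exact if_neg (by rw [Fin.val_top]; omega)

theorem eq_zero_of_foldMap_eq_zero [NeZero p] (hpn : p ≤ n) {σ : ℝ} (hσ : σ ≠ 0)
    {v : EuclideanSpace ℝ (Fin n)} (hv : foldMap hpn σ v = 0) : v = 0 := by
  ext j
  by_cases hj : (j : ℕ) + 1 < p
  · have hhead := foldMap_apply_of_lt hpn σ v (i := ⟨j, Nat.lt_of_succ_lt hj⟩) hj
    rw [hv] at hhead
    exact hhead.symm
  · have htop := foldMap_apply_top hpn σ v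
    rw [hv, PiLp.zero_apply, zero_eq_mul, or_iff_right hσ] at htop
    exact tailSq_eq_zero_iff.1 htop j (not_lt.1 hj)

theorem foldMap_zero (hpn : p ≤ n) (σ : ℝ) : foldMap hpn σ 0 = 0 := by
  ext i
  simp [foldMap, tailSq]

theorem differentiable_foldMap (hpn : p ≤ n) (σ : ℝ) : Differentiable ℝ (foldMap hpn σ) := by
  refine differentiable_euclidean.2 fun i => ?_
  by_cases hi : (i : ℕ) + 1 < p
  · simp only [foldMap, hi, if_true]
    fun_prop
  · simp only [foldMap, hi, if_false]
    exact Differentiable.const_mul (fun v => (hasFDerivAt_tailSq v).differentiableAt) σ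

theorem fderiv_foldMap_apply_of_lt (hpn : p ≤ n) (σ : ℝ) (v a : EuclideanSpace ℝ (Fin n))
    {i : Fin p} (hi : (i : ℕ) + 1 < p) :
    fderiv ℝ (foldMap hpn σ) v a i = a (Fin.castLE hpn i) := by
  have hcoord := (EuclideanSpace.proj (𝕜 := ℝ) i).hasFDerivAt.comp v
    (differentiable_foldMap hpn σ v).hasFDerivAt
  have heq : EuclideanSpace.proj (𝕜 := ℝ) i ∘ foldMap hpn σ = fun v => v (Fin.castLE hpn i) :=
    funext fun v => foldMap_apply_of_lt hpn σ v hi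
  rw [heq] at hcoord
  exact congrArg (fun L => L a)
    (hcoord.unique (EuclideanSpace.proj (𝕜 := ℝ) (Fin.castLE hpn i)).hasFDerivAt)

theorem fderiv_foldMap_apply_top [NeZero p] (hpn : p ≤ n) (σ : ℝ)
    (v a : EuclideanSpace ℝ (Fin n)) :
    fderiv ℝ (foldMap hpn σ) v a ⊤ =
      σ * ∑ j : Fin n with p ≤ j.val + 1, 2 * v j * a j := by
  have hcoord := (EuclideanSpace.proj (𝕜 := ℝ) ⊤).hasFDerivAt.comp v
    (differentiable_foldMap hpn σ v).hasFDerivAt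
  have heq : EuclideanSpace.proj (𝕜 := ℝ) ⊤ ∘ foldMap hpn σ = fun v => σ * tailSq p v :=
    funext fun v => foldMap_apply_top hpn σ v
  rw [heq] at hcoord
  refine (congrArg (fun L => L a) (hcoord.unique ((hasFDerivAt_tailSq v).const_mul σ))).trans ?_
  simp

theorem eq_of_forall_lt_of_top [NeZero p] {b b' : EuclideanSpace ℝ (Fin p)}
    (hlt : ∀ i : Fin p, (i : ℕ) + 1 < p → b i = b' i) (htop : b ⊤ = b' ⊤) : b = b' := by
  ext i
  rcases lt_or_ge ((i : ℕ) + 1) p with hi | hi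
  · exact hlt i hi
  · rwa [show i = ⊤ from Fin.ext (by rw [Fin.val_top]; omega)]

/-- The vector of `ℝ^n` with the first `p - 1` coordinates of `b`, followed by the coordinates of
`v` from the `p`-th one on. -/
def spliceHead (b : EuclideanSpace ℝ (Fin p)) (v : EuclideanSpace ℝ (Fin n)) :
    EuclideanSpace ℝ (Fin n) :=
  WithLp.toLp 2 fun j => if hj : (j : ℕ) + 1 < p then b ⟨j, by omega⟩ else v j

theorem fderiv_foldMap_spliceHead [NeZero p] (hpn : p ≤ n) (σ : ℝ) (b : EuclideanSpace ℝ (Fin p))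
    (v : EuclideanSpace ℝ (Fin n)) {c : ℝ} (hc : 2 * σ * c * tailSq p v = b ⊤) :
    fderiv ℝ (foldMap hpn σ) v (spliceHead b (c • v)) = b := by
  refine eq_of_forall_lt_of_top (fun i hi => ?_) ?_
  · rw [fderiv_foldMap_apply_of_lt hpn σ _ _ hi]
    simp [spliceHead, hi]
  · rw [fderiv_foldMap_apply_top, ← hc, tailSq, Finset.mul_sum, Finset.mul_sum]
    refine Finset.sum_congr rfl fun j hj => ?_
    have hj' : ¬ (j : ℕ) + 1 < p := not_lt.2 (Finset.mem_filter.1 hj).2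
    simp only [spliceHead, hj', dite_false, PiLp.smul_apply, smul_eq_mul]
    ring

theorem surjective_fderiv_foldMap [NeZero p] (hpn : p ≤ n) {σ : ℝ} (hσ : σ ≠ 0)
    {v : EuclideanSpace ℝ (Fin n)} (hv : tailSq p v ≠ 0) :
    Function.Surjective (fderiv ℝ (foldMap hpn σ) v) := fun b =>
  ⟨_, fderiv_foldMap_spliceHead hpn σ b v (c := b ⊤ / (2 * σ * tailSq p v)) (by field_simp)⟩

theorem exists_fderiv_foldMap_zero_eq [NeZero p] (hpn : p ≤ n) (σ : ℝ)
    {b : EuclideanSpace ℝ (Fin p)} (hb : b ⊤ = 0) : ∃ a, fderiv ℝ (foldMap hpn σ) 0 a = b :=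
  ⟨_, fderiv_foldMap_spliceHead hpn σ b 0 (c := 0) (by rw [hb, mul_zero, zero_mul])⟩

end Fold

section FoldChart

-- Here `E v₀ > 0`: a negative `E` near `v₀` would force `T ≤ 0` there.
theorem exists_pos_eq_sq_mul {V : Type*} [NormedAddCommGroup V] [NormedSpace ℝ V] {R T E : V → ℝ}
    {U : Set V} {v₀ : V} (hU : IsOpen U) (hv₀ : v₀ ∈ U) (hE : ContDiffOn ℝ ∞ E U)
    (hE0 : E v₀ ≠ 0) (hR : ∀ v, 0 ≤ R v)
    (hpos : ∃ᶠ v in 𝓝 v₀, 0 < T v) (hTE : ∀ v ∈ U, T v = R v * E v) :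
    ∃ U' ⊆ U, IsOpen U' ∧ v₀ ∈ U' ∧ ∃ w : V → ℝ,
      ContDiffOn ℝ ∞ w U' ∧ (∀ v ∈ U', 0 < w v) ∧ ∀ v ∈ U', R v = w v ^ 2 * T v := by
  have hEpos : 0 < E v₀ := by
    by_contra! hneg
    have hEneg := (hE.continuousOn.continuousAt (hU.mem_nhds hv₀)).eventually_lt_const
      (hneg.lt_of_ne hE0)
    obtain ⟨v, hTv, hEv, hv⟩ := (hpos.and_eventually (hEneg.and (hU.eventually_mem hv₀))).exists
    exact hTv.not_ge ((hTE v hv).trans_le (mul_nonpos_of_nonneg_of_nonpos (hR v) hEv.le))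
  have hU' := hE.continuousOn.isOpen_inter_preimage hU isOpen_Ioi (t := Set.Ioi 0)
  have hE' : ∀ v ∈ U ∩ E ⁻¹' Set.Ioi 0, 0 < E v := fun v hv => hv.2
  refine ⟨_, Set.inter_subset_left, hU', ⟨hv₀, hEpos⟩, fun v => (√(E v))⁻¹,
    ((hE.mono Set.inter_subset_left).sqrt fun v hv => (hE' v hv).ne').inv
      fun v hv => (Real.sqrt_pos.2 (hE' v hv)).ne',
    fun v hv => inv_pos.2 (Real.sqrt_pos.2 (hE' v hv)), fun v hv => ?_⟩
  have := (hE' v hv).ne'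
  rw [hTE v hv.1, inv_pow, Real.sq_sqrt (hE' v hv).le]
  field_simp

variable {n p : ℕ} {M : Type*} [TopologicalSpace M] [ChartedSpace (EuclideanSpace ℝ (Fin n)) M]

/-- Charts `φ`, centred at `x`, and `ψ` in which `f` is the definite fold map
`(x', x'') ↦ (x', σ ‖x''‖²)`. -/
structure IsDefiniteFoldChart (hpn : p ≤ n) (f : M → EuclideanSpace ℝ (Fin p)) (x : M)
    (φ : OpenPartialHomeomorph M (EuclideanSpace ℝ (Fin n)))
    (ψ : OpenPartialHomeomorph (EuclideanSpace ℝ (Fin p)) (EuclideanSpace ℝ (Fin p)))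
    (σ : ℝ) : Prop where
  source_mem : φ ∈ IsManifold.maximalAtlas (𝓡 n) ∞ M
  target_mem : ψ ∈ IsManifold.maximalAtlas (𝓡 p) ∞ (EuclideanSpace ℝ (Fin p))
  mem_source : x ∈ φ.source
  map_eq_zero : φ x = 0
  mapsTo : Set.MapsTo f φ.source ψ.source
  ne_zero : σ ≠ 0
  eq_foldMap : ∀ z ∈ φ.source, ψ (f z) = foldMap hpn σ (φ z)

theorem IsDefiniteFoldPoint.exists_chart [NeZero p] (hpn : p ≤ n)
    {f : M → EuclideanSpace ℝ (Fin p)} {x : M} (h : IsDefiniteFoldPoint n f x) :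
    ∃ (φ : OpenPartialHomeomorph M (EuclideanSpace ℝ (Fin n)))
      (ψ : OpenPartialHomeomorph (EuclideanSpace ℝ (Fin p)) (EuclideanSpace ℝ (Fin p))) (σ : ℝ),
      IsDefiniteFoldChart hpn f x φ ψ σ := by
  obtain ⟨l, ⟨hl, φ, hφ, ψ, hψ, hx, hx0, hmaps, hform⟩, hmax⟩ := h
  have hl' : l = n + 1 - p ∨ l = 0 := by omega
  have hp := NeZero.one_le (n := p)
  refine ⟨φ, ψ, if l = 0 then -1 else 1, hφ, hψ, hx, hx0, hmaps, by split_ifs <;> norm_num,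
    fun z hz => eq_of_forall_lt_of_top (fun i hi => ?_) ?_⟩
  · rw [(hform z hz).1 i (Fin.castLE hpn i) rfl hi, foldMap_apply_of_lt hpn _ _ hi]
  · rw [(hform z hz).2 ⊤ (by rw [Fin.val_top]; omega), foldMap_apply_top, tailSq, Finset.mul_sum,
      Finset.sum_filter]
    refine Finset.sum_congr rfl fun j _ => ?_
    rcases lt_or_ge ((j : ℕ) + 1) p with hj | hj
    · rw [if_pos hj, if_neg hj.not_ge]
    · rw [if_neg hj.not_gt, if_pos hj]
      rcases eq_or_ne l 0 with hl0 | hl0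
      · simp [hl0, hj.not_gt]
      · rw [if_pos (by omega), if_neg hl0, one_mul]

namespace IsDefiniteFoldChart

variable {hpn : p ≤ n} {f h : M → EuclideanSpace ℝ (Fin p)}
  {g : EuclideanSpace ℝ (Fin p) → EuclideanSpace ℝ (Fin p)}
  {x : M} {φ : OpenPartialHomeomorph M (EuclideanSpace ℝ (Fin n))}
  {ψ : OpenPartialHomeomorph (EuclideanSpace ℝ (Fin p)) (EuclideanSpace ℝ (Fin p))} {σ : ℝ}

theorem zero_mem_target (hc : IsDefiniteFoldChart hpn f x φ ψ σ) : 0 ∈ φ.target :=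
  hc.map_eq_zero ▸ φ.map_source hc.mem_source

theorem symm_zero (hc : IsDefiniteFoldChart hpn f x φ ψ σ) : φ.symm 0 = x := by
  rw [← hc.map_eq_zero, φ.left_inv hc.mem_source]

theorem contDiffOn_target (hc : IsDefiniteFoldChart hpn f x φ ψ σ) :
    ContDiffOn ℝ ∞ ψ ψ.source :=
  contMDiffOn_iff_contDiffOn.1 (contMDiffOn_of_mem_maximalAtlas hc.target_mem)

theorem hasFDerivAt_target (hc : IsDefiniteFoldChart hpn f x φ ψ σ)
    {y : EuclideanSpace ℝ (Fin p)} (hy : y ∈ ψ.source) : HasFDerivAt ψ (fderiv ℝ ψ y) y :=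
  ((hc.contDiffOn_target.contDiffAt (ψ.open_source.mem_nhds hy)).differentiableAt
    (by simp)).hasFDerivAt

theorem injective_fderiv_target (hc : IsDefiniteFoldChart hpn f x φ ψ σ)
    {y : EuclideanSpace ℝ (Fin p)} (hy : y ∈ ψ.source) : Function.Injective (fderiv ℝ ψ y) := by
  have hψ : ψ.MDifferentiable (𝓡 p) (𝓡 p) :=
    ⟨(contMDiffOn_of_mem_maximalAtlas hc.target_mem).mdifferentiableOn (by simp),
      (contMDiffOn_symm_of_mem_maximalAtlas hc.target_mem).mdifferentiableOn (by simp)⟩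
  rw [← mfderiv_eq_fderiv]
  exact (hψ.mfderiv_bijective hy).1

theorem tailSq_eq_zero_of_mem_singularLocus [NeZero p]
    (hf : ContMDiff (𝓡 n) (𝓡 p) ∞ f) (hc : IsDefiniteFoldChart hpn f x φ ψ σ) {z : M}
    (hz : z ∈ φ.source) (hsing : z ∈ singularLocus n f) : tailSq p (φ z) = 0 := by
  by_contra hne
  have hfz : MDifferentiableAt (𝓡 n) (𝓡 p) f z := hf.mdifferentiableAt (by simp)
  have hsymm : (f ∘ φ.symm) (φ z) = f z := congrArg f (φ.left_inv hz)
  have hψ := hc.hasFDerivAt_target (hc.mapsTo hz)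
  rw [← hsymm] at hψ
  have hcomp := (hψ.comp _ (hasFDerivAt_comp_symm_of_mem_maximalAtlas hfz hc.source_mem
    hz)).congr_of_eventuallyEq (f₁ := foldMap hpn σ) (by
      filter_upwards [φ.open_target.mem_nhds (φ.map_source hz)] with v hv
      rw [← φ.right_inv hv, ← hc.eq_foldMap _ (φ.map_target hv), φ.right_inv hv]
      rfl)
  have hsurj := surjective_fderiv_foldMap hpn hc.ne_zero hne
  rw [hcomp.fderiv] at hsurj
  refine hsing ((surjective_mfderiv_iff_of_mem_maximalAtlas hfz hc.source_mem hz).2 fun b => ?_)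
  obtain ⟨a, ha⟩ := hsurj (fderiv ℝ ψ ((f ∘ φ.symm) (φ z)) b)
  exact ⟨a, hc.injective_fderiv_target (hsymm ▸ hc.mapsTo hz) ha⟩

theorem eq_of_map_eq [NeZero p] (hc : IsDefiniteFoldChart hpn f x φ ψ σ)
    (hfac : IsDiskFactorization n f h g) {z : M} (hz : h z = h x) : z = x := by
  have := (𝓡 n).t1Space M
  have hlocal : ∀ z ∈ φ.source, h z = h x → z = x := fun z hzφ hz => by
    refine φ.injOn hzφ hc.mem_source ?_
    have hfz : f z = f x := by simp only [hfac.eq_comp, Function.comp_apply, hz]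
    rw [hc.map_eq_zero]
    refine eq_zero_of_foldMap_eq_zero hpn hc.ne_zero ?_
    rw [← hc.eq_foldMap z hzφ, hfz, hc.eq_foldMap x hc.mem_source, hc.map_eq_zero, foldMap_zero]
  by_contra hne
  obtain ⟨w, hw, hwφ, hwx⟩ := hfac.isPreconnected_preimage (h x) φ.source {x}ᶜ φ.open_source
    isOpen_compl_singleton (fun w _ => (eq_or_ne w x).imp_left fun hw : w = x => hw ▸ hc.mem_source)
    ⟨x, rfl, hc.mem_source⟩ ⟨z, hz, hne⟩
  exact hwx (hlocal w hwφ hw)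

theorem exists_preimage_ball_subset_source [NeZero p] [CompactSpace M]
    (hc : IsDefiniteFoldChart hpn f x φ ψ σ) (hfac : IsDiskFactorization n f h g) :
    ∃ r > 0, ∀ z, h z ∈ Metric.ball (h x) r → z ∈ φ.source := by
  have hnhds := hfac.contMDiff.continuous.isClosedMap.eventually_nhds_fiber (h x)
    (p := (· ∈ φ.source)) fun z hz => by
      rw [hc.eq_of_map_eq hfac hz]
      exact φ.open_source.mem_nhds hc.mem_source
  obtain ⟨r, hr, hball⟩ := Metric.eventually_nhds_iff_ball.1 hnhds
  exact ⟨r, hr, fun z hz => hball _ hz z rfl⟩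

theorem hasFDerivWithinAt_target_comp (hc : IsDefiniteFoldChart hpn f x φ ψ σ)
    (hfac : IsDiskFactorization n f h g) :
    HasFDerivWithinAt (ψ ∘ g)
      ((fderiv ℝ ψ (g (h x))).comp (fderivWithin ℝ g (Metric.closedBall 0 1) (h x)))
      (Metric.closedBall 0 1) (h x) := by
  have hgx : g (h x) ∈ ψ.source := by
    simpa only [hfac.eq_comp, Function.comp_apply] using hc.mapsTo hc.mem_source
  exact (hc.hasFDerivAt_target hgx).comp_hasFDerivWithinAt (h x)
    ((hfac.contDiffOn.differentiableOn (by simp) (h x)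
      (mem_closedBall_zero_iff.2 (hfac.norm_le_one x))).hasFDerivWithinAt)

theorem injective_fderivWithin_target_comp (hc : IsDefiniteFoldChart hpn f x φ ψ σ)
    (hfac : IsDiskFactorization n f h g) :
    Function.Injective (fderivWithin ℝ (ψ ∘ g) (Metric.closedBall 0 1) (h x)) := by
  have hx := mem_closedBall_zero_iff.2 (hfac.norm_le_one x)
  rw [(hc.hasFDerivWithinAt_target_comp hfac).fderivWithin (uniqueDiffOn_closedBall _ hx),
    ContinuousLinearMap.coe_comp]
  refine Function.Injective.comp (hc.injective_fderiv_target ?_) (hfac.injective_fderivWithin _ hx)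
  simpa only [hfac.eq_comp, Function.comp_apply] using hc.mapsTo hc.mem_source

theorem hasFDerivAt_comp_symm (hc : IsDefiniteFoldChart hpn f x φ ψ σ)
    (hfac : IsDiskFactorization n f h g) :
    HasFDerivAt (h ∘ φ.symm) (fderiv ℝ (h ∘ φ.symm) 0) 0 := by
  have hφ := hasFDerivAt_comp_symm_of_mem_maximalAtlas
    (hfac.contMDiff.mdifferentiableAt (by simp)) hc.source_mem hc.mem_source
  rwa [hc.map_eq_zero] at hφ

theorem fderivWithin_target_comp_fderiv (hc : IsDefiniteFoldChart hpn f x φ ψ σ)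
    (hfac : IsDiskFactorization n f h g) (a : EuclideanSpace ℝ (Fin n)) :
    fderivWithin ℝ (ψ ∘ g) (Metric.closedBall 0 1) (h x) (fderiv ℝ (h ∘ φ.symm) 0 a) =
      fderiv ℝ (foldMap hpn σ) 0 a := by
  have hψg := (hc.hasFDerivWithinAt_target_comp hfac).differentiableWithinAt.hasFDerivWithinAt
  have hx : (h ∘ φ.symm) 0 = h x := congrArg h hc.symm_zero
  rw [← hx] at hψg ⊢
  have hcomp := hψg.comp_hasFDerivAt 0 (hc.hasFDerivAt_comp_symm hfac)
    (Filter.Eventually.of_forall fun v => mem_closedBall_zero_iff.2 (hfac.norm_le_one _))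
  have hfold := hcomp.congr_of_eventuallyEq (f₁ := foldMap hpn σ) (by
    filter_upwards [φ.open_target.mem_nhds hc.zero_mem_target] with v hv
    rw [← φ.right_inv hv, ← hc.eq_foldMap _ (φ.map_target hv), φ.right_inv hv, hfac.eq_comp]
    rfl)
  rw [hfold.fderiv]
  rfl

theorem inner_fderiv_comp_symm_eq_zero (hc : IsDefiniteFoldChart hpn f x φ ψ σ)
    (hfac : IsDiskFactorization n f h g) (hx : ‖h x‖ = 1) (a : EuclideanSpace ℝ (Fin n)) :
    inner ℝ (h x) (fderiv ℝ (h ∘ φ.symm) 0 a) = 0 := by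
  have hx₀ : (h ∘ φ.symm) 0 = h x := congrArg h hc.symm_zero
  rw [← hx₀] at hx ⊢
  exact inner_eq_zero_of_isLocalMax_norm (hc.hasFDerivAt_comp_symm hfac)
    (Filter.Eventually.of_forall fun v => (hfac.norm_le_one _).trans_eq hx.symm) a

-- If it vanished, `h x` would lie in the range of the differential of `h` at `x`, which is
-- orthogonal to `h x` because `‖h‖` is maximal there.
theorem fderivWithin_target_comp_apply_top_ne_zero [NeZero p]
    (hc : IsDefiniteFoldChart hpn f x φ ψ σ) (hfac : IsDiskFactorization n f h g)
    (hx : ‖h x‖ = 1) :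
    fderivWithin ℝ (fun y => ψ (g y) ⊤) (Metric.closedBall 0 1) (h x) (h x) ≠ 0 := by
  have hmem := mem_closedBall_zero_iff.2 (hfac.norm_le_one x)
  have hψg := (hc.hasFDerivWithinAt_target_comp hfac).differentiableWithinAt.hasFDerivWithinAt
  have htop := ((EuclideanSpace.proj (𝕜 := ℝ) (⊤ : Fin p)).hasFDerivAt.comp_hasFDerivWithinAt
    (h x) hψg).fderivWithin (uniqueDiffOn_closedBall _ hmem)
  intro h0
  obtain ⟨a, ha⟩ := exists_fderiv_foldMap_zero_eq hpn σ
    ((congrArg (fun L => L (h x)) htop).symm.trans h0)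
  rw [← hc.fderivWithin_target_comp_fderiv hfac] at ha
  have hortho := hc.inner_fderiv_comp_symm_eq_zero hfac hx a
  rw [hc.injective_fderivWithin_target_comp hfac ha, real_inner_self_eq_norm_sq, hx] at hortho
  norm_num at hortho

theorem target_comp_apply_top [NeZero p] (hc : IsDefiniteFoldChart hpn f x φ ψ σ)
    (hfac : IsDiskFactorization n f h g) {z : M} (hz : z ∈ φ.source) :
    ψ (g (h z)) ⊤ = σ * tailSq p (φ z) := by
  rw [← foldMap_apply_top hpn, ← hc.eq_foldMap z hz, hfac.eq_comp]
  rfl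

theorem exists_contDiffOn_target_comp_apply_top [NeZero p] [CompactSpace M]
    (hf : ContMDiff (𝓡 n) (𝓡 p) ∞ f)
    (hc : IsDefiniteFoldChart hpn f x φ ψ σ) (hfac : IsDiskFactorization n f h g) :
    ∃ r > 0, ContDiffOn ℝ ∞ (fun y => ψ (g y) ⊤)
        (Metric.closedBall 0 1 ∩ Metric.ball (h x) r) ∧
      ∀ y ∈ Metric.ball (h x) r, ‖y‖ = 1 → ψ (g y) ⊤ = 0 := by
  obtain ⟨r, hr, hsource⟩ := hc.exists_preimage_ball_subset_source hfac
  have hrange : ∀ y ∈ Metric.closedBall 0 1, ∃ z, h z = y := fun y hy =>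
    hfac.range_eq.ge hy
  refine ⟨r, hr, ?_, fun y hy hy1 => ?_⟩
  · refine contDiffOn_euclidean.1 ((hc.contDiffOn_target.comp
      (hfac.contDiffOn.mono Set.inter_subset_left)) ?_) ⊤
    rintro y ⟨hy, hyr⟩
    obtain ⟨z, rfl⟩ := hrange y hy
    simpa only [hfac.eq_comp, Function.comp_apply] using hc.mapsTo (hsource z hyr)
  · obtain ⟨z, rfl⟩ := hrange y (mem_closedBall_zero_iff.2 hy1.le)
    rw [hc.target_comp_apply_top hfac (hsource z hy), hc.tailSq_eq_zero_of_mem_singularLocus hf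
      (hsource z hy) ((hfac.mem_singularLocus_iff z).2 hy1), mul_zero]

theorem exists_one_sub_norm_sq_eq_sq_mul_tailSq [NeZero p] [CompactSpace M]
    (hf : ContMDiff (𝓡 n) (𝓡 p) ∞ f)
    (hc : IsDefiniteFoldChart hpn f x φ ψ σ) (hfac : IsDiskFactorization n f h g)
    (hx : ‖h x‖ = 1) :
    ∃ U ⊆ φ.target, IsOpen U ∧ 0 ∈ U ∧ ∃ w : EuclideanSpace ℝ (Fin n) → ℝ,
      ContDiffOn ℝ ∞ w U ∧ (∀ v ∈ U, 0 < w v) ∧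
      ∀ v ∈ U, 1 - ‖h (φ.symm v)‖ ^ 2 = w v ^ 2 * tailSq p v := by
  have hx₀ : (h ∘ φ.symm) 0 = h x := congrArg h hc.symm_zero
  obtain ⟨r, hr, hG, hG0⟩ := hc.exists_contDiffOn_target_comp_apply_top hf hfac
  have hE := hc.fderivWithin_target_comp_apply_top_ne_zero hfac hx
  rw [← hx₀] at hx hG hG0 hE
  obtain ⟨U, hUφ, hU, h0U, E, hEsmooth, hGE, hE0⟩ :=
    exists_comp_eq_one_sub_norm_sq_mul φ.open_target hc.zero_mem_target
      (contMDiffOn_iff_contDiffOn.1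
        (hfac.contMDiff.comp_contMDiffOn (contMDiffOn_symm_of_mem_maximalAtlas hc.source_mem)))
      (fun v _ => hfac.norm_le_one _) hx hr hG hG0
  obtain ⟨U', hU'U, hU', h0U', w, hw, hwpos, hRw⟩ :=
    exists_pos_eq_sq_mul hU h0U (R := fun v => 1 - ‖h (φ.symm v)‖ ^ 2) (T := tailSq p)
      (hEsmooth.div_const σ)
      (div_ne_zero (hE0 ▸ div_ne_zero (neg_ne_zero.2 hE) two_ne_zero) hc.ne_zero)
      (fun v => sub_nonneg.2 (pow_le_one₀ (norm_nonneg _) (hfac.norm_le_one _)))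
      (frequently_tailSq_pos hpn) fun v hv => by
        have hv' := hc.target_comp_apply_top hfac (φ.map_target (hUφ hv))
        rw [φ.right_inv (hUφ hv)] at hv'
        rw [← mul_div_assoc, eq_div_iff hc.ne_zero, mul_comm, ← hv']
        exact hGE v hv
  exact ⟨U', hU'U.trans hUφ, hU', h0U', w, hw, hwpos, hRw⟩

end IsDefiniteFoldChart

end FoldChart

section AdaptedChart

variable {n p : ℕ} {M : Type*} [TopologicalSpace M] [ChartedSpace (EuclideanSpace ℝ (Fin n)) M]

theorem trans_mem_maximalAtlas [IsManifold (𝓡 n) ∞ M]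
    {φ : OpenPartialHomeomorph M (EuclideanSpace ℝ (Fin n))}
    (hφ : φ ∈ IsManifold.maximalAtlas (𝓡 n) ∞ M)
    {e : OpenPartialHomeomorph (EuclideanSpace ℝ (Fin n)) (EuclideanSpace ℝ (Fin n))}
    (he : e ∈ contDiffGroupoid ∞ (𝓡 n)) : φ ≫ₕ e ∈ IsManifold.maximalAtlas (𝓡 n) ∞ M := by
  refine OpenPartialHomeomorph.mem_maximalAtlas_of_contMDiffOn _ ?_ ?_
  · exact (contMDiffOn_of_mem_contDiffGroupoid he).comp
      ((contMDiffOn_of_mem_maximalAtlas hφ).mono fun x hx => hx.1) fun x hx => hx.2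
  · exact (contMDiffOn_symm_of_mem_maximalAtlas hφ).comp
      ((contMDiffOn_of_mem_contDiffGroupoid ((contDiffGroupoid ∞ (𝓡 n)).symm he)).mono
        fun x hx => hx.1) fun x hx => hx.2

/-- A chart `χ` of `M`, centred at `x`, whose first `p - 1` coordinates are components of `h`, in
the order given by `e` and normalized at `x`, while the squares of the others sum up to
`1 - ‖h‖²`. -/
structure IsAdaptedChart (hpn : p ≤ n) (h : M → EuclideanSpace ℝ (Fin p))
    (e : Equiv.Perm (Fin p)) (x : M) (χ : OpenPartialHomeomorph M (EuclideanSpace ℝ (Fin n))) :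
    Prop where
  mem_maximalAtlas : χ ∈ IsManifold.maximalAtlas (𝓡 n) ∞ M
  mem_source : x ∈ χ.source
  map_eq_zero : χ x = 0
  head : ∀ z ∈ χ.source, ∀ i : Fin p, (i : ℕ) + 1 < p →
    χ z (Fin.castLE hpn i) = h z (e i) - h x (e i)
  tail : ∀ z ∈ χ.source, tailSq p (χ z) = 1 - ‖h z‖ ^ 2

namespace IsDefiniteFoldChart

variable [NeZero p] {hpn : p ≤ n} {f h : M → EuclideanSpace ℝ (Fin p)}
  {g : EuclideanSpace ℝ (Fin p) → EuclideanSpace ℝ (Fin p)}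
  {x : M} {φ : OpenPartialHomeomorph M (EuclideanSpace ℝ (Fin n))}
  {ψ : OpenPartialHomeomorph (EuclideanSpace ℝ (Fin p)) (EuclideanSpace ℝ (Fin p))} {σ : ℝ}
  {e : Equiv.Perm (Fin p)}

theorem eq_zero_of_fderiv_comp_symm_apply_eq_zero (hc : IsDefiniteFoldChart hpn f x φ ψ σ)
    (hfac : IsDiskFactorization n f h g) (hx : ‖h x‖ = 1) (he : h x (e ⊤) ≠ 0)
    {a : EuclideanSpace ℝ (Fin n)}
    (hhead : ∀ i : Fin p, (i : ℕ) + 1 < p → fderiv ℝ (h ∘ φ.symm) 0 a (e i) = 0)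
    (htail : ∀ j : Fin n, p ≤ (j : ℕ) + 1 → a j = 0) : a = 0 := by
  have hDh : fderiv ℝ (h ∘ φ.symm) 0 a = 0 := by
    refine eq_zero_of_inner_eq_zero_of_forall_ne he
      (hc.inner_fderiv_comp_symm_eq_zero hfac hx a) fun k hk => ?_
    obtain ⟨i, rfl⟩ := e.surjective k
    have hi : (i : ℕ) < ((⊤ : Fin p) : ℕ) := lt_top_iff_ne_top.2 (e.injective.ne_iff.1 hk)
    rw [Fin.val_top] at hi
    exact hhead i (by omega)
  have hfold := hc.fderivWithin_target_comp_fderiv hfac a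
  rw [hDh, map_zero] at hfold
  ext j
  rcases lt_or_ge ((j : ℕ) + 1) p with hj | hj
  · have hcoord := fderiv_foldMap_apply_of_lt hpn σ 0 a (i := ⟨j, Nat.lt_of_succ_lt hj⟩) hj
    rw [← hfold] at hcoord
    exact hcoord.symm
  · exact htail j hj

theorem exists_adapted_coordinates (hc : IsDefiniteFoldChart hpn f x φ ψ σ)
    (hfac : IsDiskFactorization n f h g) (hx : ‖h x‖ = 1) (he : h x (e ⊤) ≠ 0)
    {U : Set (EuclideanSpace ℝ (Fin n))} (hU : IsOpen U) (hUφ : U ⊆ φ.target) (h0U : 0 ∈ U)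
    {w : EuclideanSpace ℝ (Fin n) → ℝ} (hw : ContDiffOn ℝ ∞ w U) (hw0 : w 0 ≠ 0) :
    ∃ ε ∈ contDiffGroupoid ∞ (𝓡 n), 0 ∈ ε.source ∧ ε.source ⊆ U ∧
      (∀ v, ∀ i : Fin p, (i : ℕ) + 1 < p →
        ε v (Fin.castLE hpn i) = h (φ.symm v) (e i) - h x (e i)) ∧
      ∀ v, ∀ j : Fin n, p ≤ (j : ℕ) + 1 → ε v j = w v * v j := by
  let κ : Fin n → EuclideanSpace ℝ (Fin n) → ℝ := fun j v =>
    if hj : (j : ℕ) + 1 < p then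
      h (φ.symm v) (e ⟨j, Nat.lt_of_succ_lt hj⟩) - h x (e ⟨j, Nat.lt_of_succ_lt hj⟩)
    else w v * v j
  have hhead : ∀ i : Fin p, (i : ℕ) + 1 < p →
      κ (Fin.castLE hpn i) = fun v => (h ∘ φ.symm) v (e i) - h x (e i) := fun i hi =>
    funext fun v => dif_pos hi
  have htail : ∀ j : Fin n, p ≤ (j : ℕ) + 1 → κ j = fun v => w v * v j := fun j hj =>
    funext fun v => dif_neg hj.not_gt
  have hκ : ∀ j, ContDiffOn ℝ ∞ (κ j) U := fun j => by
    rcases lt_or_ge ((j : ℕ) + 1) p with hj | hj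
    · refine (hhead ⟨j, Nat.lt_of_succ_lt hj⟩ hj).symm ▸ ContDiffOn.sub ?_ contDiffOn_const
      exact contDiffOn_euclidean.1 ((contMDiffOn_iff_contDiffOn.1 (hfac.contMDiff.comp_contMDiffOn
        (contMDiffOn_symm_of_mem_maximalAtlas hc.source_mem))).mono hUφ) _
    · exact htail j hj ▸ hw.mul (by fun_prop)
  have hinj : ∀ a, (∀ j, fderiv ℝ (κ j) 0 a = 0) → a = 0 := fun a ha => by
    refine hc.eq_zero_of_fderiv_comp_symm_apply_eq_zero hfac hx he (fun i hi => ?_)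
      fun j hj => ?_
    · have hcoord := ((EuclideanSpace.proj (𝕜 := ℝ) (e i)).hasFDerivAt.comp 0
        (hc.hasFDerivAt_comp_symm hfac)).sub_const (h x (e i))
      have hzero := ha (Fin.castLE hpn i)
      rw [hhead i hi] at hzero
      exact (congrArg (fun L => L a) hcoord.fderiv).symm.trans hzero
    · have hprod := ((hw.contDiffAt (hU.mem_nhds h0U)).differentiableAt
        (by simp)).hasFDerivAt.mul (EuclideanSpace.proj (𝕜 := ℝ) j).hasFDerivAt
      have hzero := ha j
      rw [htail j hj] at hzero
      simpa [hw0] using (congrArg (fun L => L a) hprod.fderiv).symm.trans hzero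
  obtain ⟨ε, hε, h0ε, hεU, hεκ⟩ := exists_mem_contDiffGroupoid_of_coordinates hU h0U hκ hinj
  exact ⟨ε, hε, h0ε, hεU, fun v i hi => by rw [hεκ, hhead i hi]; rfl,
    fun v j hj => by rw [hεκ, htail j hj]⟩

end IsDefiniteFoldChart

theorem exists_isAdaptedChart [NeZero p] [CompactSpace M] [IsManifold (𝓡 n) ∞ M]
    {f h : M → EuclideanSpace ℝ (Fin p)} {g : EuclideanSpace ℝ (Fin p) → EuclideanSpace ℝ (Fin p)}
    (hf : IsSpecialGeneric n f) (hfac : IsDiskFactorization n f h g) {x : M} (hx : ‖h x‖ = 1)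
    {e : Equiv.Perm (Fin p)} (he : h x (e ⊤) ≠ 0) : ∃ χ, IsAdaptedChart hf.le h e x χ := by
  obtain ⟨φ, ψ, σ, hc⟩ :=
    (hf.definite x ((hfac.mem_singularLocus_iff x).2 hx)).exists_chart hf.le
  obtain ⟨U, hUφ, hU, h0U, w, hw, hwpos, hnorm⟩ :=
    hc.exists_one_sub_norm_sq_eq_sq_mul_tailSq hf.smooth hfac hx
  obtain ⟨ε, hε, h0ε, hεU, hhead, htail⟩ :=
    hc.exists_adapted_coordinates hfac hx he hU hUφ h0U hw (hwpos 0 h0U).ne'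
  refine ⟨φ ≫ₕ ε, trans_mem_maximalAtlas hc.source_mem hε, ⟨hc.mem_source, ?_⟩, ?_,
    fun z hz i hi => ?_, fun z hz => ?_⟩
  · change φ x ∈ ε.source
    rwa [hc.map_eq_zero]
  · ext j
    rw [OpenPartialHomeomorph.coe_trans, Function.comp_apply, hc.map_eq_zero]
    rcases lt_or_ge ((j : ℕ) + 1) p with hj | hj
    · exact (hhead 0 ⟨j, Nat.lt_of_succ_lt hj⟩ hj).trans (by rw [hc.symm_zero, sub_self]; rfl)
    · rw [htail 0 j hj]
      exact mul_zero _
  · exact (hhead (φ z) i hi).trans (by rw [φ.left_inv hz.1])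
  · have hz' := hnorm (φ z) (hεU hz.2)
    rw [φ.left_inv hz.1] at hz'
    rw [hz', tailSq, tailSq, Finset.mul_sum]
    refine Finset.sum_congr rfl fun j hj => ?_
    rw [← mul_pow]
    exact congrArg (· ^ 2) (htail (φ z) j (Finset.mem_filter.1 hj).2)

end AdaptedChart

section Projection

variable {n p q : ℕ}

/-- The projection `projFirst : ℝ^p → ℝ^q` as a continuous linear map. -/
noncomputable def projFirstL (hqp : q ≤ p) :
    EuclideanSpace ℝ (Fin p) →L[ℝ] EuclideanSpace ℝ (Fin q) :=
  LinearMap.toContinuousLinearMap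
    { toFun := projFirst hqp
      map_add' := fun _ _ => rfl
      map_smul' := fun _ _ => rfl }

theorem coe_projFirstL (hqp : q ≤ p) : ⇑(projFirstL hqp) = projFirst hqp := rfl

theorem norm_projFirst_sq_add_tailSq (hqp : q ≤ p) (y : EuclideanSpace ℝ (Fin p)) :
    ‖projFirst hqp y‖ ^ 2 + tailSq (q + 1) y = ‖y‖ ^ 2 := by
  have hhead : ∑ i : Fin q, y (Fin.castLE hqp i) ^ 2 =
      ∑ k : Fin p with ¬ q + 1 ≤ k.val + 1, y k ^ 2 :=
    Finset.sum_nbij (Fin.castLE hqp) (fun i _ => by simp) (Fin.castLE_injective hqp).injOn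
      (fun k hk => ⟨⟨k, by simpa using hk⟩, by simp, rfl⟩) fun _ _ => rfl
  rw [EuclideanSpace.real_norm_sq_eq, EuclideanSpace.real_norm_sq_eq, tailSq, add_comm,
    ← Finset.sum_filter_add_sum_filter_not Finset.univ (fun k : Fin p => q + 1 ≤ k.val + 1),
    ← hhead]
  rfl

theorem norm_projFirst_le (hqp : q ≤ p) (y : EuclideanSpace ℝ (Fin p)) :
    ‖projFirst hqp y‖ ≤ ‖y‖ :=
  (sq_le_sq₀ (norm_nonneg _) (norm_nonneg _)).1
    (norm_projFirst_sq_add_tailSq hqp y ▸ le_add_of_nonneg_right (tailSq_nonneg y))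

theorem exists_projFirst_eq_norm_eq (hqp : q ≤ p) (z : EuclideanSpace ℝ (Fin q)) :
    ∃ y : EuclideanSpace ℝ (Fin p), projFirst hqp y = z ∧ ‖y‖ = ‖z‖ := by
  let y : EuclideanSpace ℝ (Fin p) := WithLp.toLp 2 (Function.extend (Fin.castLE hqp) z 0)
  have hyz : projFirst hqp y = z := by
    ext i
    exact (Fin.castLE_injective hqp).extend_apply _ _ _
  have htail : tailSq (q + 1) y = 0 := tailSq_eq_zero_iff.2 fun k hk =>
    Function.extend_apply' _ _ _ fun ⟨i, hi⟩ => by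
      have := congrArg Fin.val hi
      simp only [Fin.val_castLE] at this
      omega
  refine ⟨y, hyz, ?_⟩
  rw [← sq_eq_sq₀ (norm_nonneg _) (norm_nonneg _), ← norm_projFirst_sq_add_tailSq hqp y, htail,
    hyz, add_zero]

theorem projFirst_image_closedBall (hqp : q ≤ p) :
    projFirst hqp '' Metric.closedBall 0 1 = Metric.closedBall 0 1 := by
  ext z
  simp only [Set.mem_image, mem_closedBall_zero_iff]
  constructor
  · rintro ⟨y, hy, rfl⟩
    exact (norm_projFirst_le hqp y).trans hy
  · intro hz
    obtain ⟨y, rfl, hy⟩ := exists_projFirst_eq_norm_eq hqp z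
    exact ⟨y, hy.trans_le hz, rfl⟩

theorem surjective_of_apply_eq {ι : Fin q → Fin n} (hι : Function.Injective ι)
    {L : EuclideanSpace ℝ (Fin n) → EuclideanSpace ℝ (Fin q)} (hL : ∀ a i, L a i = a (ι i)) :
    Function.Surjective L := fun b =>
  ⟨WithLp.toLp 2 (Function.extend ι b 0), by
    ext i
    rw [hL]
    exact hι.extend_apply _ _ _⟩

theorem tailSq_eq_tailSq_add_tailSq [NeZero q] (hqp : q ≤ p) (hpn : p ≤ n)
    {v : EuclideanSpace ℝ (Fin n)} {y : EuclideanSpace ℝ (Fin p)}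
    (hvy : ∀ (k : Fin p) (j : Fin n), q ≤ (k : ℕ) → (j : ℕ) + 1 = k → v j = y k) :
    tailSq q v = tailSq p v + tailSq (q + 1) y := by
  have hq := NeZero.one_le (n := q)
  have hmiddle : tailSq (q + 1) y =
      ∑ j : Fin n with q ≤ j.val + 1 ∧ ¬ p ≤ j.val + 1, v j ^ 2 := by
    refine Finset.sum_bij (fun k _ => ⟨k - 1, by omega⟩) (fun k hk => ?_)
      (fun k hk k' hk' h => ?_) (fun j hj => ?_) fun k hk => ?_
    · simp only [Finset.mem_filter_univ] at hk ⊢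
      omega
    · simp only [Finset.mem_filter_univ, Fin.mk.injEq] at hk hk' h
      omega
    · simp only [Finset.mem_filter_univ] at hj
      exact ⟨⟨j + 1, by omega⟩, by simpa using hj.1, rfl⟩
    · simp only [Finset.mem_filter_univ] at hk
      rw [hvy k _ (by omega) (by simp only; omega)]
  rw [hmiddle, tailSq, tailSq,
    ← Finset.sum_filter_add_sum_filter_not _ (fun j : Fin n => p ≤ j.val + 1),
    Finset.filter_filter, Finset.filter_filter]
  congr 2
  ext j
  simp only [Finset.mem_filter_univ]
  omega

-- Dropping the last entry of the enumeration `e` removes the component `i₀` and keeps the others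
-- of `ℝ^q` in front of those of index at least `q`, which move down by one place.
theorem exists_perm_castLE [NeZero p] [NeZero q] (hqp : q ≤ p) (i₀ : Fin q) :
    ∃ (e : Equiv.Perm (Fin p)) (τ : Equiv.Perm (Fin q)), e ⊤ = Fin.castLE hqp i₀ ∧ τ ⊤ = i₀ ∧
      (∀ i : Fin q, (i : ℕ) + 1 < q → e (Fin.castLE hqp i) = Fin.castLE hqp (τ i)) ∧
      ∀ k i : Fin p, q ≤ (k : ℕ) → (i : ℕ) + 1 = k → e i = k := by
  have hq := NeZero.one_le (n := q)
  have htop := Fin.val_top q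
  refine ⟨(Fin.cycleIcc (Fin.castLE hqp ⊤) ⊤).trans
    (Equiv.swap (Fin.castLE hqp i₀) (Fin.castLE hqp ⊤)), Equiv.swap i₀ ⊤, ?_,
    Equiv.swap_apply_right _ _, fun i hi => ?_, fun k i hk hik => ?_⟩
  · rw [Equiv.trans_apply, Fin.cycleIcc_of_last le_top, Equiv.swap_apply_right]
  · rw [Equiv.trans_apply, Fin.cycleIcc_of_lt (Fin.lt_def.2 (by simp only [Fin.val_castLE]; omega)),
      (Fin.castLE_injective hqp).swap_apply]
  · have hi : i < ⊤ := Fin.lt_def.2 (by rw [Fin.val_top]; omega)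
    have hik' : i + 1 = k := Fin.ext (by rw [Fin.val_add_one_of_lt' (by omega), hik])
    have hne : ∀ i : Fin q, k ≠ Fin.castLE hqp i := fun i h => by
      have := congrArg Fin.val h
      simp only [Fin.val_castLE] at this
      omega
    rw [Equiv.trans_apply, Fin.cycleIcc_of_ge_of_lt
      (Fin.le_def.2 (by simp only [Fin.val_castLE]; omega)) hi, hik',
      Equiv.swap_apply_of_ne_of_ne (hne _) (hne _)]

variable {M : Type*} [TopologicalSpace M] [ChartedSpace (EuclideanSpace ℝ (Fin n)) M]

theorem contMDiff_projFirst_comp (hqp : q ≤ p) {h : M → EuclideanSpace ℝ (Fin p)}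
    (hh : ContMDiff (𝓡 n) (𝓡 p) ∞ h) : ContMDiff (𝓡 n) (𝓡 q) ∞ (projFirst hqp ∘ h) :=
  (projFirstL hqp).contDiff.contMDiff.comp hh

theorem isPreconnected_preimage_projFirst_comp {X : Type*} [TopologicalSpace X] (hqp : q ≤ p)
    {h : X → EuclideanSpace ℝ (Fin p)} (hh : IsClosedMap h)
    (hrange : Set.range h = Metric.closedBall 0 1) (hfib : ∀ y, IsPreconnected (h ⁻¹' {y}))
    (z : EuclideanSpace ℝ (Fin q)) : IsPreconnected ((projFirst hqp ∘ h) ⁻¹' {z}) := by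
  have hconvex : Convex ℝ (projFirst hqp ⁻¹' {z} ∩ Metric.closedBall 0 1) :=
    ((convex_singleton z).linear_preimage (projFirstL hqp).toLinearMap).inter
      (convex_closedBall 0 1)
  have hpre := isPreconnected_preimage_of_isClosedMap hh hfib hconvex.isPreconnected
    (Set.inter_subset_right.trans hrange.ge)
  rwa [← hrange, Set.preimage_inter_range] at hpre

theorem surjective_mfderiv_projFirst_comp (hqp : q ≤ p) {h : M → EuclideanSpace ℝ (Fin p)} {x : M}
    (hh : MDifferentiableAt (𝓡 n) (𝓡 p) h x)
    (hsurj : Function.Surjective (mfderiv (𝓡 n) (𝓡 p) h x)) :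
    Function.Surjective (mfderiv (𝓡 n) (𝓡 q) (projFirst hqp ∘ h) x) := by
  have hcomp := (projFirstL hqp).hasMFDerivAt.comp x hh.hasMFDerivAt
  rw [coe_projFirstL] at hcomp
  intro b
  obtain ⟨y, hy, -⟩ := exists_projFirst_eq_norm_eq hqp b
  obtain ⟨a, ha⟩ := hsurj y
  exact ⟨a, (congrArg (fun L => L a) hcomp.mfderiv).trans
    ((congrArg (projFirst hqp) ha).trans hy)⟩

theorem IsAdaptedChart.surjective_mfderiv_projFirst_comp [NeZero p]
    {hpn : p ≤ n} {h : M → EuclideanSpace ℝ (Fin p)} {e : Equiv.Perm (Fin p)} {x : M}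
    {χ : OpenPartialHomeomorph M (EuclideanSpace ℝ (Fin n))} (hχ : IsAdaptedChart hpn h e x χ)
    (hh : MDifferentiableAt (𝓡 n) (𝓡 p) h x) (hqp : q ≤ p) (he : q ≤ (e ⊤ : ℕ)) :
    Function.Surjective (mfderiv (𝓡 n) (𝓡 q) (projFirst hqp ∘ h) x) := by
  have hπh : MDifferentiableAt (𝓡 n) (𝓡 q) (projFirst hqp ∘ h) x :=
    (projFirstL hqp).mdifferentiableAt.comp x hh
  have hhead : ∀ i : Fin q, (e.symm (Fin.castLE hqp i) : ℕ) + 1 < p := fun i => by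
    have hne : e.symm (Fin.castLE hqp i) ≠ ⊤ := fun h => by
      rw [← h, e.apply_symm_apply, Fin.val_castLE] at he
      omega
    have := Fin.lt_def.1 (lt_top_iff_ne_top.2 hne)
    rw [Fin.val_top] at this
    omega
  refine (surjective_mfderiv_iff_of_mem_maximalAtlas hπh hχ.mem_maximalAtlas hχ.mem_source).2
    (surjective_of_apply_eq (ι := fun i => Fin.castLE hpn (e.symm (Fin.castLE hqp i)))
      ((Fin.castLE_injective hpn).comp (e.symm.injective.comp (Fin.castLE_injective hqp)))
      fun a i => ?_)
  have hcoord := (EuclideanSpace.proj (𝕜 := ℝ) i).hasFDerivAt.comp _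
    (hasFDerivAt_comp_symm_of_mem_maximalAtlas hπh hχ.mem_maximalAtlas hχ.mem_source)
  have hproj := ((EuclideanSpace.proj (𝕜 := ℝ) (Fin.castLE hpn (e.symm (Fin.castLE hqp
    i)))).hasFDerivAt (x := χ x)).add_const (h x (Fin.castLE hqp i))
  refine congrArg (fun L => L a) (hcoord.unique (hproj.congr_of_eventuallyEq ?_))
  filter_upwards [χ.open_target.mem_nhds (χ.map_source hχ.mem_source)] with v hv
  have hv' := hχ.head _ (χ.map_target hv) _ (hhead i)
  rw [χ.right_inv hv, e.apply_symm_apply] at hv'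
  exact sub_eq_iff_eq_add.1 hv'.symm

theorem isDefiniteFoldPoint_of_eq_foldMap [NeZero p] (hpn : p ≤ n)
    {f : M → EuclideanSpace ℝ (Fin p)} (hf : Continuous f) {x : M}
    {χ : OpenPartialHomeomorph M (EuclideanSpace ℝ (Fin n))}
    (hχ : χ ∈ IsManifold.maximalAtlas (𝓡 n) ∞ M) (hxχ : x ∈ χ.source) (hχx : χ x = 0)
    {ε : OpenPartialHomeomorph (EuclideanSpace ℝ (Fin p)) (EuclideanSpace ℝ (Fin p))}
    (hε : ε ∈ IsManifold.maximalAtlas (𝓡 p) ∞ (EuclideanSpace ℝ (Fin p))) (hxε : f x ∈ ε.source)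
    (hfold : ∀ z ∈ χ.source, ε (f z) = foldMap hpn 1 (χ z)) : IsDefiniteFoldPoint n f x := by
  have hp := NeZero.one_le (n := p)
  have hopen := ε.open_source.preimage hf
  have hsource := χ.restr_source' _ hopen
  refine ⟨n + 1 - p, ⟨le_rfl, χ.restr (f ⁻¹' ε.source),
    restr_mem_maximalAtlas (contDiffGroupoid ∞ (𝓡 n)) hχ hopen, ε, hε,
    hsource.ge ⟨hxχ, hxε⟩, hχx, fun z hz => (hsource.le hz).2,
    fun z hz => ⟨fun i j hij hi => ?_, fun i hi => ?_⟩⟩, by omega⟩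
  · rw [hfold z (hsource.le hz).1, foldMap_apply_of_lt hpn 1 _ hi]
    exact congrArg (χ z) (Fin.ext hij)
  · rw [hfold z (hsource.le hz).1, show i = ⊤ from Fin.ext (by rw [Fin.val_top]; omega),
      foldMap_apply_top, one_mul, tailSq, Finset.sum_filter]
    refine Finset.sum_congr rfl fun j _ => ?_
    rcases lt_or_ge ((j : ℕ) + 1) p with hj | hj
    · rw [if_pos hj, if_neg hj.not_ge]
    · rw [if_neg hj.not_gt, if_pos hj, if_pos (by omega)]
      rfl

end Projection

section StandardProjection

variable {n p q : ℕ} {M : Type*} [TopologicalSpace M]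
  [ChartedSpace (EuclideanSpace ℝ (Fin n)) M]
  {f h : M → EuclideanSpace ℝ (Fin p)} {g : EuclideanSpace ℝ (Fin p) → EuclideanSpace ℝ (Fin p)}

namespace IsDiskFactorization

theorem norm_eq_one_of_mem_singularLocus_projFirst_comp
    (hfac : IsDiskFactorization n f h g) (hqp : q ≤ p) {x : M}
    (hx : x ∈ singularLocus n (projFirst hqp ∘ h)) : ‖h x‖ = 1 := by
  have hh := hfac.contMDiff.mdifferentiableAt (by simp) (x := x)
  have hball : ∀ x, h x ∈ Metric.closedBall 0 1 := fun x =>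
    mem_closedBall_zero_iff.2 (hfac.norm_le_one x)
  by_contra hne
  have hf : Function.Surjective (mfderiv (𝓡 n) (𝓡 p) f x) :=
    not_not.1 (mt (hfac.mem_singularLocus_iff x).1 hne)
  rw [hfac.eq_comp] at hf
  exact hx (surjective_mfderiv_projFirst_comp hqp hh (surjective_mfderiv_of_comp hh hfac.contDiffOn
    hball (hfac.injective_fderivWithin _ (hball x)) hf))

theorem norm_eq_one_and_tailSq_eq_zero (hfac : IsDiskFactorization n f h g) (hqp : q ≤ p) {x : M}
    (hx : ‖projFirst hqp (h x)‖ = 1) : ‖h x‖ = 1 ∧ tailSq (q + 1) (h x) = 0 := by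
  have hx1 : ‖h x‖ = 1 :=
    (hfac.norm_le_one x).antisymm (hx.symm.trans_le (norm_projFirst_le hqp _))
  have hsum := norm_projFirst_sq_add_tailSq hqp (h x)
  rw [hx, hx1] at hsum
  exact ⟨hx1, add_eq_left.1 hsum⟩

variable [NeZero p] [CompactSpace M] [IsManifold (𝓡 n) ∞ M]

theorem mem_singularLocus_projFirst_comp_iff (hf : IsSpecialGeneric n f)
    (hfac : IsDiskFactorization n f h g) (hqp : q ≤ p) (x : M) :
    x ∈ singularLocus n (projFirst hqp ∘ h) ↔ ‖projFirst hqp (h x)‖ = 1 := by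
  have hh := hfac.contMDiff.mdifferentiableAt (by simp) (x := x)
  refine ⟨fun hx => ?_, fun hx hsurj => ?_⟩
  · have hx1 := hfac.norm_eq_one_of_mem_singularLocus_projFirst_comp hqp hx
    have htail : tailSq (q + 1) (h x) = 0 := tailSq_eq_zero_iff.2 fun k hk => by
      by_contra hne
      have he : Equiv.swap k ⊤ ⊤ = k := Equiv.swap_apply_right k ⊤
      obtain ⟨χ, hχ⟩ := exists_isAdaptedChart hf hfac hx1 (he.symm ▸ hne)
      exact hx (hχ.surjective_mfderiv_projFirst_comp hh hqp (by rw [he]; omega))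
    have hnorm := norm_projFirst_sq_add_tailSq hqp (h x)
    rw [htail, add_zero, hx1, one_pow] at hnorm
    exact (pow_eq_one_iff_of_nonneg (norm_nonneg _) two_ne_zero).1 hnorm
  · exact (norm_lt_one_of_surjective_mfderiv
      ((contMDiff_projFirst_comp hqp hfac.contMDiff).mdifferentiableAt (by simp))
      (fun x => (norm_projFirst_le hqp _).trans (hfac.norm_le_one x)) hsurj).ne hx

theorem exists_projFirst_eq_foldMap [NeZero q] (hf : IsSpecialGeneric n f)
    (hfac : IsDiskFactorization n f h g) (hqp : q ≤ p) {x : M}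
    (hx : ‖projFirst hqp (h x)‖ = 1) :
    ∃ χ ∈ IsManifold.maximalAtlas (𝓡 n) ∞ M, x ∈ χ.source ∧ χ x = 0 ∧
      ∃ ε ∈ contDiffGroupoid ∞ (𝓡 q), projFirst hqp (h x) ∈ ε.source ∧
        ∀ z ∈ χ.source, ε (projFirst hqp (h z)) = foldMap (hqp.trans hf.le) 1 (χ z) := by
  obtain ⟨hx1, htail⟩ := hfac.norm_eq_one_and_tailSq_eq_zero hqp hx
  rw [tailSq_eq_zero_iff] at htail
  obtain ⟨i₀, hi₀⟩ : ∃ i₀, projFirst hqp (h x) i₀ ≠ 0 := by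
    by_contra! hzero
    rw [show projFirst hqp (h x) = 0 from PiLp.ext hzero, norm_zero] at hx
    exact zero_ne_one hx
  obtain ⟨e, τ, he, hτ, heτ, heshift⟩ := exists_perm_castLE hqp i₀
  obtain ⟨χ, hχ⟩ := exists_isAdaptedChart hf hfac hx1 (e := e) (he.symm ▸ hi₀)
  obtain ⟨ε, hε, hxε, hεval⟩ := exists_sphere_coordinates τ (r := ⊤) (hτ.symm ▸ hi₀)
    fun i => projFirst hqp (h x) (τ i)
  have hq := NeZero.one_le (n := q)
  refine ⟨χ, hχ.mem_maximalAtlas, hχ.mem_source, hχ.map_eq_zero, ε, hε, hxε,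
    fun z hz => eq_of_forall_lt_of_top (fun i hi => ?_) ?_⟩
  · rw [hεval, if_neg (fun h => by rw [h, Fin.val_top] at hi; omega),
      foldMap_apply_of_lt _ _ _ hi]
    exact ((hχ.head z hz (Fin.castLE hqp i) (by simp only [Fin.val_castLE]; omega)).trans
      (by rw [heτ i hi]; rfl)).symm
  · rw [hεval, if_pos rfl, foldMap_apply_top, one_mul]
    refine Eq.trans ?_ (tailSq_eq_tailSq_add_tailSq hqp hf.le (y := h z) fun k j hk hjk => ?_).symm
    · rw [hχ.tail z hz, ← norm_projFirst_sq_add_tailSq hqp]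
      ring
    · have hhead := hχ.head z hz ⟨j, by omega⟩ (by simp only; omega)
      rw [heshift k _ hk hjk, htail k (by omega), sub_zero] at hhead
      exact hhead

theorem isSpecialGeneric_projFirst_comp [NeZero q] (hf : IsSpecialGeneric n f)
    (hfac : IsDiskFactorization n f h g) (hqp : q ≤ p) :
    IsSpecialGeneric n (projFirst hqp ∘ h) := by
  refine ⟨NeZero.one_le, hqp.trans hf.le, contMDiff_projFirst_comp hqp hfac.contMDiff,
    fun x hx => ?_⟩
  obtain ⟨χ, hχ, hxχ, hχx, ε, hε, hxε, hfold⟩ := hfac.exists_projFirst_eq_foldMap hf hqp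
    ((hfac.mem_singularLocus_projFirst_comp_iff hf hqp x).1 hx)
  exact isDefiniteFoldPoint_of_eq_foldMap _ (contMDiff_projFirst_comp hqp hfac.contMDiff).continuous
    hχ hxχ hχx (StructureGroupoid.mem_maximalAtlas_of_mem_groupoid _ hε) hxε hfold

end IsDiskFactorization

end StandardProjection

theorem mainTheorem5_general {n p q : ℕ} [NeZero p] [NeZero q]
    {M : Type*} [TopologicalSpace M] [ChartedSpace (EuclideanSpace ℝ (Fin n)) M]
    [IsManifold (𝓡 n) ∞ M] [CompactSpace M]
    {f : M → EuclideanSpace ℝ (Fin p)} (hf : IsSpecialGeneric n f)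
    [ChartedSpace (EuclideanHalfSpace p) (SteinSpace f)] (hW : IsSteinSmoothStructure n f)
    {Φ : SteinSpace f → EuclideanSpace ℝ (Fin p)} (hΦ : IsDiffeoOntoDisk Φ) (hqp : q ≤ p) :
    IsSpecialGeneric n (projFirst hqp ∘ Φ ∘ steinQuot f) ∧
      ∃ _ : ChartedSpace (EuclideanHalfSpace q) (SteinSpace (projFirst hqp ∘ Φ ∘ steinQuot f)),
        IsSteinSmoothStructure n (projFirst hqp ∘ Φ ∘ steinQuot f) ∧
          ∃ Φ' : SteinSpace (projFirst hqp ∘ Φ ∘ steinQuot f) → EuclideanSpace ℝ (Fin q),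
            IsDiffeoOntoDisk Φ' := by
  obtain ⟨g, hfac⟩ := exists_isDiskFactorization hW hΦ
  have hrange : Set.range (projFirst hqp ∘ Φ ∘ steinQuot f) = Metric.closedBall 0 1 := by
    rw [Set.range_comp, hfac.range_eq, projFirst_image_closedBall]
  exact ⟨hfac.isSpecialGeneric_projFirst_comp hf hqp,
    exists_isSteinSmoothStructure (contMDiff_projFirst_comp hqp hfac.contMDiff) hrange
      (isPreconnected_preimage_projFirst_comp hqp hfac.contMDiff.continuous.isClosedMap
        hfac.range_eq hfac.isPreconnected_preimage)
      (hfac.mem_singularLocus_projFirst_comp_iff hf hqp)⟩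

/-- `h = Φ ∘ q_f` for a fixed diffeomorphism `Φ : W_f ≅ D^p ⊂ ℝ^p`; `NeZero q` and `q < p` say
`q ∈ {1, …, p - 1}`. -/
theorem mainTheorem5 {n p : ℕ} [NeZero p]
    {M : Type*} [TopologicalSpace M] [ChartedSpace (EuclideanSpace ℝ (Fin n)) M]
    (f : M → EuclideanSpace ℝ (Fin p)) (hf : IsStandardSpecialGeneric n f)
    [ChartedSpace (EuclideanHalfSpace p) (SteinSpace f)] (hW : IsSteinSmoothStructure n f)
    (Φ : SteinSpace f → EuclideanSpace ℝ (Fin p)) (hΦ : IsDiffeoOntoDisk Φ) :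
    IsStandardSpecialGeneric n (Φ ∘ steinQuot f) ∧
      ∀ (q : ℕ) [NeZero q] (hqp : q < p),
        IsStandardSpecialGeneric n (projFirst hqp.le ∘ Φ ∘ steinQuot f) := by
  have := hf.homotopySphere.isManifold
  have := hf.homotopySphere.compactSpace
  have hproj : ∀ (q : ℕ) [NeZero q] (hqp : q ≤ p),
      IsStandardSpecialGeneric n (projFirst hqp ∘ Φ ∘ steinQuot f) := fun q _ hqp =>
    have hgeneral := mainTheorem5_general hf.specialGeneric hW hΦ hqp
    ⟨hf.homotopySphere, hqp.trans_lt hf.lt, hgeneral.1, hgeneral.2⟩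
  exact ⟨hproj p le_rfl, fun q _ hqp => hproj q hqp.le⟩
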